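/- Let $d\ge 1$, let $\mathbb T^d=\mathbb R^d/2\pi\mathbb Z^d$ be the flat torus and let $S\mathbb T^d=\mathbb T^d\times\mathbb S^{d-1}$ be its unit tangent bundle, equipped with the geodesic flow $e^{tV}(x,\theta)=(x+t\theta,\theta)$, $V=\theta\cdot\partial_x$, and with the Liouville measure $dx\otimes d\mathrm{Vol}(\theta)$. For $\varphi,\psi\in C^\infty(S\mathbb T^d)$ (complex-valued) let $$\mathrm{Cor}_{\varphi,\psi}(t)=\int_{S\mathbb T^d}\varphi(x+t\theta,\theta)\,\overline{\psi(x,\theta)}\,dx\,d\mathrm{Vol}(\theta),$$ and let $$\mathcal F(\mathrm{Cor}_{\varphi,\psi})(\tau)=\int_0^\infty e^{-i\tau t}\,\mathrm{Cor}_{\varphi,\psi}(t)\,dt\in\mathcal S'(\mathbb R),$$ understood as the Fourier transform of the bounded function $\mathbf 1_{(0,\infty)}\mathrm{Cor}_{\varphi,\psi}$ in the sense of tempered distributions, that is, $$\langle \mathcal F(\mathrm{Cor}_{\varphi,\psi}),\chi\rangle=\int_0^\infty \mathrm{Cor}_{\varphi,\psi}(t)\Big(\int_{\mathbb R}e^{-it\tau}\chi(\tau)\,d\tau\Big)dt,\qquad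 \chi\in\mathcal S(\mathbb R).$$ Let $\Delta=\sum_{j=1}^d\partial_{x_j}^2$ be the Laplacian on $\mathbb T^d$, and let $\mathrm{Sp}(\sqrt{-\Delta})$ be the spectrum of $\sqrt{-\Delta}$, i.e. the set of $\lambda\ge 0$ such that $\lambda^2$ is an eigenvalue of $-\Delta$; put $\mathrm{Sp}(-\sqrt{-\Delta})=-\mathrm{Sp}(\sqrt{-\Delta})$. The singular support of a distribution is the complement of the largest open set on which it is given by a $C^\infty$ function. Then, for all $\varphi,\psi\in C^\infty(S\mathbb T^d)$, $$\operatorname{sing\,supp}\mathcal F(\mathrm{Cor}_{\varphi,\psi})\subset \mathrm{Sp}(\sqrt{-\Delta})\cup\mathrm{Sp}(-\sqrt{-\Delta}).$$ -/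

import Mathlib

open Set MeasureTheory
open scoped ContDiff Manifold SchwartzMap FourierTransform ENNReal

namespace TorusFlow

instance factTwoPiPos : Fact (0 < 2 * Real.pi) := ⟨Real.two_pi_pos⟩

/-- The flat torus `𝕋ᵈ = ℝᵈ / 2πℤᵈ`. Its canonical measure `volume` is the Lebesgue measure `dx`,
of total mass `(2π)ᵈ`. -/
abbrev Torus (d : ℕ) : Type := Fin d → AddCircle (2 * Real.pi)

/-- The unit sphere `𝕊ᵈ⁻¹` of the Euclidean space `ℝᵈ`. -/
abbrev USphere (d : ℕ) : Type := Metric.sphere (0 : EuclideanSpace ℝ (Fin d)) 1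

/-- The unit tangent bundle `S𝕋ᵈ = 𝕋ᵈ × 𝕊ᵈ⁻¹`. -/
abbrev STorus (d : ℕ) : Type := Torus d × USphere d

/-- The canonical projection `ℝᵈ → 𝕋ᵈ`. -/
noncomputable def proj (d : ℕ) (x : EuclideanSpace ℝ (Fin d)) : Torus d :=
  fun i => (x i : AddCircle (2 * Real.pi))

/-- `φ ∈ C^∞(S𝕋ᵈ)`, where `d = n + 1`: the projection `ℝᵈ → 𝕋ᵈ` being a smooth covering, this means
that the lift of `φ` to the manifold `ℝᵈ × 𝕊ᵈ⁻¹` is smooth. -/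
def IsSmooth {n : ℕ} (φ : STorus (n + 1) → ℂ) : Prop :=
  ContMDiff ((𝓡 (n + 1)).prod (𝓡 n)) 𝓘(ℝ, ℂ) ∞
    (fun p : EuclideanSpace ℝ (Fin (n + 1)) × USphere (n + 1) => φ (proj (n + 1) p.1, p.2))

/-- The geodesic flow `e^{tV} : (x, θ) ↦ (x + tθ, θ)`, generated by `V = θ · ∂ₓ`. -/
noncomputable def geodesicFlow (d : ℕ) (t : ℝ) (p : STorus d) : STorus d :=
  (fun i => p.1 i + ((t * (p.2 : EuclideanSpace ℝ (Fin d)) i : ℝ) : AddCircle (2 * Real.pi)), p.2)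

/-- The Liouville measure `dx ⊗ dVol(θ)` on `S𝕋ᵈ`; `dVol` is the surface measure of `𝕊ᵈ⁻¹`. -/
noncomputable def liouville (d : ℕ) : Measure (STorus d) :=
  (volume : Measure (Torus d)).prod
    (volume : Measure (EuclideanSpace ℝ (Fin d))).toSphere

/-- The correlation function `Cor_{φ,ψ}(t) = (e^{tV} φ, ψ)` in `L²(S𝕋ᵈ)`. -/
noncomputable def cor {d : ℕ} (φ ψ : STorus d → ℂ) (t : ℝ) : ℂ :=
  ∫ p, φ (geodesicFlow d t p) * (starRingEnd ℂ) (ψ p) ∂(liouville d)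

instance isFiniteMeasureLiouville (d : ℕ) : IsFiniteMeasure (liouville d) := by
  unfold liouville; infer_instance

theorem continuous_proj (d : ℕ) : Continuous (proj d) := by
  unfold proj
  refine continuous_pi fun i => ?_
  exact (AddCircle.continuous_mk' _).comp (by fun_prop : Continuous
    fun x : EuclideanSpace ℝ (Fin d) => x i)

theorem isOpenQuotientMap_proj (d : ℕ) : IsOpenQuotientMap (proj d) := by
  have h : IsOpenQuotientMap (fun (x : Fin d → ℝ) (i : Fin d) =>
      (x i : AddCircle (2 * Real.pi))) :=
    IsOpenQuotientMap.piMap fun _ => QuotientAddGroup.isOpenQuotientMap_mk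
  exact h.comp (EuclideanSpace.equiv (Fin d) ℝ).toHomeomorph.isOpenQuotientMap

theorem IsSmooth.continuous {n : ℕ} {φ : STorus (n + 1) → ℂ} (hφ : IsSmooth φ) :
    Continuous φ := by
  have h : IsOpenQuotientMap (Prod.map (proj (n + 1)) (id : USphere (n + 1) → _)) :=
    (isOpenQuotientMap_proj _).prodMap IsOpenQuotientMap.id
  exact h.isQuotientMap.continuous_iff.2 (ContMDiff.continuous hφ)

theorem continuous_geodesicFlow (d : ℕ) :
    Continuous fun q : ℝ × STorus d => geodesicFlow d q.1 q.2 := by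
  unfold geodesicFlow
  refine Continuous.prodMk (continuous_pi fun i => ?_) (by fun_prop)
  refine Continuous.add (by fun_prop) ((AddCircle.continuous_mk' _).comp ?_)
  fun_prop

theorem continuous_cor {d : ℕ} {φ ψ : STorus d → ℂ} (hφ : Continuous φ) (hψ : Continuous ψ) :
    Continuous (cor φ ψ) := by
  have h : Continuous (Function.uncurry fun (t : ℝ) (p : STorus d) =>
      φ (geodesicFlow d t p) * (starRingEnd ℂ) (ψ p)) :=
    (hφ.comp (continuous_geodesicFlow d)).mul
      (Complex.continuous_conj.comp (hψ.comp continuous_snd))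
  have h' := continuous_parametric_integral_of_continuous (μ := liouville d) h isCompact_univ
  simp only [Measure.restrict_univ] at h'
  exact h'

theorem memLp_cor {d : ℕ} {φ ψ : STorus d → ℂ} (hφ : Continuous φ) (hψ : Continuous ψ) :
    MemLp ((Ioi (0 : ℝ)).indicator (cor φ ψ)) ∞ volume := by
  obtain ⟨A, hA⟩ := isCompact_univ.exists_bound_of_continuousOn hφ.continuousOn
  obtain ⟨B, hB⟩ := isCompact_univ.exists_bound_of_continuousOn hψ.continuousOn
  refine MemLp.indicator measurableSet_Ioi
    (memLp_top_of_bound (continuous_cor hφ hψ).aestronglyMeasurable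
      (A * B * (liouville d).real univ) (Filter.Eventually.of_forall fun t => ?_))
  refine norm_integral_le_of_norm_le_const (Filter.Eventually.of_forall fun p => ?_)
  rw [norm_mul, RCLike.norm_conj]
  exact mul_le_mul (hA _ (mem_univ _)) (hB _ (mem_univ _)) (norm_nonneg _)
    ((norm_nonneg _).trans (hA (geodesicFlow d t p) (mem_univ _)))

/-- The Fourier transform `χ ↦ (t ↦ ∫ e^{-itτ} χ(τ) dτ)` on Schwartz functions, which is Mathlib's
Fourier transform (with phase `-2πi`) after rescaling; see `schwartzFourier_apply`. -/
noncomputable def schwartzFourier : 𝓢(ℝ, ℂ) →L[ℂ] 𝓢(ℝ, ℂ) :=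
  (SchwartzMap.compCLMOfContinuousLinearEquiv ℂ
    (ContinuousLinearEquiv.unitsEquivAut ℝ
      (Units.mk0 (2 * Real.pi)⁻¹ (inv_ne_zero Real.two_pi_pos.ne')))).comp
    (FourierTransform.fourierCLM ℂ 𝓢(ℝ, ℂ))

theorem schwartzFourier_apply (χ : 𝓢(ℝ, ℂ)) (t : ℝ) :
    schwartzFourier χ t = ∫ τ : ℝ, Complex.exp (-(Complex.I * t * τ)) * χ τ := by
  have h : schwartzFourier χ t = (𝓕 χ) (t * (2 * Real.pi)⁻¹) := rfl
  rw [h, SchwartzMap.fourier_coe, Real.fourier_eq']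
  refine integral_congr_ae (Filter.Eventually.of_forall fun τ => ?_)
  simp only [smul_eq_mul]
  congr 2
  have := Real.pi_ne_zero
  simp
  field_simp

/-- The Fourier transform on tempered distributions, `⟨𝓕 u, χ⟩ = ⟨u, 𝓕 χ⟩`, for the normalization
`𝓕 χ (t) = ∫ e^{-itτ} χ(τ) dτ`. -/
noncomputable def distFourier (u : 𝓢'(ℝ, ℂ)) : 𝓢'(ℝ, ℂ) :=
  PointwiseConvergenceCLM.precomp ℂ schwartzFourier u

/-- The Fourier transform `∫_0^∞ e^{-iτt} Cor_{φ,ψ}(t) dt` of the correlation function, as a tempered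
distribution in `τ`: the Fourier transform of the bounded function `1_{(0,∞)} Cor_{φ,ψ}`. -/
noncomputable def fourierCor {n : ℕ} {φ ψ : STorus (n + 1) → ℂ} (hφ : IsSmooth φ)
    (hψ : IsSmooth ψ) : 𝓢'(ℝ, ℂ) :=
  distFourier (Lp.toTemperedDistribution (memLp_cor hφ.continuous hψ.continuous).toLp)

theorem fourierCor_apply {n : ℕ} {φ ψ : STorus (n + 1) → ℂ} (hφ : IsSmooth φ)
    (hψ : IsSmooth ψ) (χ : 𝓢(ℝ, ℂ)) :
    fourierCor hφ hψ χ = ∫ t in Ioi (0 : ℝ),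
      cor φ ψ t * ∫ τ : ℝ, Complex.exp (-(Complex.I * t * τ)) * χ τ := by
  have h : fourierCor hφ hψ χ =
      Lp.toTemperedDistribution (memLp_cor hφ.continuous hψ.continuous).toLp
        (schwartzFourier χ) := rfl
  rw [h, Lp.toTemperedDistribution_apply, ← integral_indicator measurableSet_Ioi]
  refine integral_congr_ae ?_
  filter_upwards [(memLp_cor hφ.continuous hψ.continuous).coeFn_toLp] with t ht
  rw [ht, schwartzFourier_apply]
  by_cases h0 : t ∈ Ioi (0 : ℝ)
  · rw [indicator_of_mem h0, indicator_of_mem h0, smul_eq_mul, mul_comm]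
  · rw [indicator_of_notMem h0, indicator_of_notMem h0, smul_zero]

/-- The distribution `T` is `C^∞` on the set `U`: it is given there by a smooth function. -/
def IsSmoothOn (T : 𝓢'(ℝ, ℂ)) (U : Set ℝ) : Prop :=
  ∃ f : ℝ → ℂ, ContDiffOn ℝ ∞ f U ∧
    ∀ χ : 𝓢(ℝ, ℂ), HasCompactSupport χ → tsupport χ ⊆ U → T χ = ∫ τ : ℝ, f τ * χ τ

/-- The singular support of a distribution: the complement of the largest open set on which it
is `C^∞`. -/
def singSupport (T : 𝓢'(ℝ, ℂ)) : Set ℝ :=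
  (⋃₀ {U : Set ℝ | IsOpen U ∧ IsSmoothOn T U})ᶜ

/-- `μ` is an eigenvalue of `-Δ` on `𝕋ᵈ`: there is a nonzero smooth function `u` on the torus (that
is, one with a smooth lift to `ℝᵈ`) such that `-Δ u = μ u`, for `Δ = ∑ⱼ ∂²/∂xⱼ²`. -/
def IsLaplaceEigenvalue (d : ℕ) (μ : ℝ) : Prop :=
  ∃ u : Torus d → ℂ, u ≠ 0 ∧ ContDiff ℝ ∞ (fun x => u (proj d x)) ∧
    ∀ x, -(Laplacian.laplacian (fun y => u (proj d y)) x) = (μ : ℂ) * u (proj d x)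

/-- `Sp(√-Δ)` on `𝕋ᵈ`. As the torus is compact, the spectrum of `-Δ` consists of its eigenvalues,
which are nonnegative, and the spectrum of `√-Δ` consists of their square roots. -/
def spSqrtLaplacian (d : ℕ) : Set ℝ :=
  {l : ℝ | 0 ≤ l ∧ IsLaplaceEigenvalue d (l ^ 2)}

/-- `Sp(-√-Δ)` on `𝕋ᵈ`. -/
def spNegSqrtLaplacian (d : ℕ) : Set ℝ :=
  {l : ℝ | -l ∈ spSqrtLaplacian d}

end TorusFlow

namespace TorusFlow

/-! ### Parameter integrals over compact quotients -/

section ParametricIntegral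

universe u

/-! Expanding in characters along the torus writes the correlation as a sum over k ∈ ℤᵈ of integrals
∫ e^{it k·θ} B_k(θ) dθ over the sphere (`hasSum_cor`). The critical values of the phase k·θ are
±|k|, so the k-th term should be singular only at the frequencies ±|k|, which lie in ±Sp(√-Δ).

To make this uniform in k, take l outside the spectrum. The numbers |k|² are integers, so some bump
χ equal to 1 near l has support at distance at least δ from every ±|k| (`exists_gap`). Let H be a
Schwartz kernel with transform χ. Pairing the correlation with H(t - s) inserts χ(k·θ) into each
integral (`hasSum_integral_mul_cor`), and nonstationary phase gives decay faster than any power of s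
(`exists_pow_mul_norm_oscIntegral_le`). The denominators that occur are factors of |k|² - (k·θ)² =
(|k| - k·θ)(|k| + k·θ), each at least δ in absolute value on the support. An integration by parts
also costs a derivative along k; smoothness along the torus absorbs this loss and leaves a
convergent sum (`IsTorusAnnular.exists_summable_norm_iterate_le`).

Sphere integrals are realised as integrals over an annulus in ℝᵈ, with θ = y/|y| and a radial bump.
One then integrates by parts along the constant field k, without charts. The cases d = 1 and k = 0
need no separate treatment: there k·θ is always ±|k|, so χ(k·θ) vanishes.

Finally, restricting to t > 0 changes the filtered function only by a rapidly decaying error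
(`exists_pow_mul_norm_setIntegral_le`). The Fourier transform of the result is smooth and, by
duality, represents the distribution wherever χ = 1 (`exists_contDiff_integral_eq`). -/

theorem continuous_uncurry_of_lift {X V Y Z : Type*} [TopologicalSpace X] [TopologicalSpace V]
    [TopologicalSpace Y] [TopologicalSpace Z] {p : V → X} (hp : IsOpenQuotientMap p) {g : X → Y → Z}
    (hg : Continuous fun a : V × Y => g (p a.1) a.2) : Continuous (Function.uncurry g) := by
  have h : IsOpenQuotientMap (Prod.map p (id : Y → Y)) := hp.prodMap IsOpenQuotientMap.id
  exact h.isQuotientMap.continuous_iff.2 hg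

theorem contDiff_fderiv_of_lift {X V W F : Type*} [NormedAddCommGroup V] [NormedSpace ℝ V]
    [NormedAddCommGroup W] [NormedSpace ℝ W] [NormedAddCommGroup F] [NormedSpace ℝ F]
    {p : V → X} {g : X → W → F}
    (hg : ContDiff ℝ ∞ fun a : V × W => g (p a.1) a.2) :
    ContDiff ℝ ∞ fun a : V × W => fderiv ℝ (g (p a.1)) a.2 := by
  refine ContDiff.fderiv (m := ∞) (f := fun a : V × W => g (p a.1)) ?_ contDiff_snd (by simp)
  exact hg.comp ((contDiff_fst.comp contDiff_fst).prodMk contDiff_snd)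

variable {X V : Type*} {W F : Type u} [TopologicalSpace X] [CompactSpace X]
  [SecondCountableTopology X] [MeasurableSpace X] [OpensMeasurableSpace X]
  {μ : Measure X} [IsFiniteMeasure μ]
  [NormedAddCommGroup V] [NormedSpace ℝ V] [NormedAddCommGroup W] [NormedSpace ℝ W]
  [ProperSpace W] [NormedAddCommGroup F] [NormedSpace ℝ F] {p : V → X}

/-- Differentiation under the integral sign over a compact space covered by a normed space. -/
theorem hasFDerivAt_integral_of_lift (hp : IsOpenQuotientMap p) {g : X → W → F}
    (hg : ContDiff ℝ ∞ fun a : V × W => g (p a.1) a.2) (w : W) :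
    HasFDerivAt (fun w => ∫ x, g x w ∂μ) (∫ x, fderiv ℝ (g x) w ∂μ) w := by
  have hc := continuous_uncurry_of_lift (g := g) hp hg.continuous
  have hc' := continuous_uncurry_of_lift (g := fun (x : X) (w : W) => fderiv ℝ (g x) w) hp
    (contDiff_fderiv_of_lift hg).continuous
  have hX (w : W) : Continuous fun x => g x w := hc.comp (by fun_prop : Continuous fun x => (x, w))
  have hX' (w : W) : Continuous fun x => fderiv ℝ (g x) w :=
    hc'.comp (by fun_prop : Continuous fun x => (x, w))
  obtain ⟨C, hC⟩ := (isCompact_univ.prod (isCompact_closedBall w 1)).exists_bound_of_continuousOn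
    hc'.continuousOn
  refine hasFDerivAt_integral_of_dominated_of_fderiv_le (𝕜 := ℝ) (bound := fun _ => C)
    (F := fun w x => g x w) (F' := fun w x => fderiv ℝ (g x) w)
    (Metric.ball_mem_nhds w one_pos) ?_ ?_ ?_ ?_ (integrable_const (μ := μ) C) ?_
  · exact Filter.Eventually.of_forall fun w => (hX w).aestronglyMeasurable
  · exact (hX w).integrable_of_hasCompactSupport (HasCompactSupport.of_compactSpace _)
  · exact (hX' w).aestronglyMeasurable
  · exact Filter.Eventually.of_forall fun x y hy =>
      hC (x, y) ⟨mem_univ _, Metric.ball_subset_closedBall hy⟩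
  · refine Filter.Eventually.of_forall fun x y _ => ?_
    obtain ⟨v, rfl⟩ := hp.surjective x
    have : ContDiff ℝ ∞ fun y => g (p v) y :=
      hg.comp ((contDiff_const (c := v)).prodMk contDiff_id)
    exact (this.differentiable (by simp) y).hasFDerivAt

/-- Integrals over a compact space covered by a normed space depend smoothly on parameters. -/
theorem contDiff_integral_of_lift (hp : IsOpenQuotientMap p) {g : X → W → F}
    (hg : ContDiff ℝ ∞ fun a : V × W => g (p a.1) a.2) :
    ContDiff ℝ ∞ fun w => ∫ x, g x w ∂μ := by
  rw [contDiff_infty]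
  intro n
  -- The derivative takes values in `W →L[ℝ] F`, so the target must vary; this is why `W` and `F`
  -- share a universe.
  induction n generalizing F with
  | zero =>
    refine contDiff_zero.2 (continuous_iff_continuousAt.2 fun w => ?_)
    exact (hasFDerivAt_integral_of_lift hp hg w).continuousAt
  | succ n ih =>
    rw [Nat.cast_succ, contDiff_succ_iff_hasFDerivAt]
    exact ⟨fun w => ∫ x, fderiv ℝ (g x) w ∂μ, ih (contDiff_fderiv_of_lift hg),
      hasFDerivAt_integral_of_lift hp hg⟩

theorem integral_fderiv_apply_of_lift (hp : IsOpenQuotientMap p) {g : X → W → F} [CompleteSpace F]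
    (hg : ContDiff ℝ ∞ fun a : V × W => g (p a.1) a.2) (w v : W) :
    ∫ x, fderiv ℝ (g x) w v ∂μ = fderiv ℝ (fun w => ∫ x, g x w ∂μ) w v := by
  have hc := continuous_uncurry_of_lift (g := fun (x : X) (w : W) => fderiv ℝ (g x) w) hp
    (contDiff_fderiv_of_lift hg).continuous
  have hc' : Continuous fun x => fderiv ℝ (g x) w :=
    hc.comp (by fun_prop : Continuous fun x => (x, w))
  rw [(hasFDerivAt_integral_of_lift (μ := μ) hp hg w).fderiv, ContinuousLinearMap.integral_apply]
  exact hc'.integrable_of_hasCompactSupport (HasCompactSupport.of_compactSpace _)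

end ParametricIntegral

end TorusFlow

namespace TorusFlow

/-! ### Integration by parts in the radial component -/

section Oscillatory

variable {E : Type*} [NormedAddCommGroup E] [InnerProductSpace ℝ E]

/-- The component of `k` along the direction of `y`. -/
noncomputable def radialComponent (k y : E) : ℝ := inner ℝ k y / ‖y‖

theorem continuousAt_radialComponent (k : E) {y : E} (hy : y ≠ 0) :
    ContinuousAt (radialComponent k) y := by
  unfold radialComponent
  exact ContinuousAt.div (by fun_prop) (by fun_prop) (norm_ne_zero_iff.2 hy)

/-- The numerator is the squared spherical gradient of θ ↦ k·θ. It vanishes only where the radial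
component is ±‖k‖, which is what confines the singular frequencies. -/
theorem hasLineDerivAt_radialComponent (k : E) {y : E} (hy : y ≠ 0) :
    HasLineDerivAt ℝ (radialComponent k) ((‖k‖ ^ 2 - radialComponent k y ^ 2) / ‖y‖) y k := by
  have hy' : ‖y‖ ≠ 0 := norm_ne_zero_iff.2 hy
  have h0 : HasDerivAt (fun t : ℝ => y + t • k) k 0 := by
    simpa using ((hasDerivAt_id (0 : ℝ)).smul_const k).const_add y
  have h1 : HasDerivAt (fun t : ℝ => ‖y + t • k‖) (inner ℝ k y / ‖y‖) 0 := by
    have := h0.norm_sq.sqrt (by simpa using hy)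
    simp only [Real.sqrt_sq (norm_nonneg _), zero_smul, add_zero] at this
    rwa [mul_div_mul_left _ _ two_ne_zero, real_inner_comm] at this
  have h2 : HasDerivAt (fun t : ℝ => (inner ℝ k (y + t • k) : ℝ)) (‖k‖ ^ 2) 0 := by
    have := (hasDerivAt_const (0 : ℝ) k).inner ℝ h0
    simpa [real_inner_self_eq_norm_sq] using this
  have h3 := h2.div h1 (by simpa using hy)
  simp only [zero_smul, add_zero] at h3
  unfold HasLineDerivAt radialComponent
  exact h3.congr_deriv (by field_simp)

/-- Smooth functions supported in the annulus `1 ≤ ‖y‖ ≤ 2`. -/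
structure IsAnnular (B : E → ℂ) : Prop where
  contDiff : ContDiff ℝ ∞ B
  eq_zero_of_lt : ∀ y, ‖y‖ < 1 → B y = 0
  eq_zero_of_gt : ∀ y, 2 < ‖y‖ → B y = 0

/-- The operator `B ↦ ∂ₖ(‖y‖ B)`. -/
noncomputable def radialDeriv (k : E) (B : E → ℂ) (y : E) : ℂ :=
  fderiv ℝ (fun y => ‖y‖ • B y) y k

theorem eventually_norm_lt_one {E : Type*} [NormedAddCommGroup E] {y : E} (hy : ‖y‖ < 1) :
    ∀ᶠ z in nhds y, ‖z‖ < 1 :=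
  (isOpen_lt continuous_norm continuous_const).mem_nhds hy

theorem eventually_two_lt_norm {E : Type*} [NormedAddCommGroup E] {y : E} (hy : 2 < ‖y‖) :
    ∀ᶠ z in nhds y, 2 < ‖z‖ :=
  (isOpen_lt continuous_const continuous_norm).mem_nhds hy

/-- Weighting by the norm preserves smoothness of functions vanishing near the origin. -/
theorem contDiff_norm_smul {V F : Type*} [NormedAddCommGroup V] [NormedSpace ℝ V]
    [NormedAddCommGroup F] [NormedSpace ℝ F] {B : V × E → F} (hB : ContDiff ℝ ∞ B)
    (h0 : ∀ a, ‖a.2‖ < 1 → B a = 0) : ContDiff ℝ ∞ fun a => ‖a.2‖ • B a := by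
  rw [contDiff_iff_contDiffAt]
  intro a
  rcases lt_or_ge ‖a.2‖ 1 with h | h
  · refine (contDiffAt_const (c := (0 : F))).congr_of_eventuallyEq ?_
    filter_upwards [continuous_snd.continuousAt.eventually (eventually_norm_lt_one h)] with z hz
    simp [h0 z hz]
  · have : a.2 ≠ 0 := norm_pos_iff.1 (by linarith)
    exact ((contDiffAt_norm ℝ this).comp a contDiffAt_snd).smul hB.contDiffAt

theorem IsAnnular.norm_smul {B : E → ℂ} (hB : IsAnnular B) : IsAnnular fun y => ‖y‖ • B y where
  contDiff := (contDiff_norm_smul (V := ℝ) (hB.contDiff.comp contDiff_snd)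
    fun a => hB.eq_zero_of_lt a.2).comp (contDiff_const (c := (0 : ℝ)).prodMk contDiff_id)
  eq_zero_of_lt y hy := by simp [hB.eq_zero_of_lt y hy]
  eq_zero_of_gt y hy := by simp [hB.eq_zero_of_gt y hy]

theorem IsAnnular.radialDeriv {B : E → ℂ} (hB : IsAnnular B) (k : E) :
    IsAnnular (radialDeriv k B) where
  contDiff := (hB.norm_smul.contDiff.fderiv_right (by simp)).clm_apply contDiff_const
  eq_zero_of_lt y hy := by
    have : (fun y => ‖y‖ • B y) =ᶠ[nhds y] fun _ => 0 := by
      filter_upwards [eventually_norm_lt_one hy] with z hz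
      simp [hB.eq_zero_of_lt z hz]
    rw [TorusFlow.radialDeriv, this.fderiv_eq]
    simp
  eq_zero_of_gt y hy := by
    have : (fun y => ‖y‖ • B y) =ᶠ[nhds y] fun _ => 0 := by
      filter_upwards [eventually_two_lt_norm hy] with z hz
      simp [hB.eq_zero_of_gt z hz]
    rw [TorusFlow.radialDeriv, this.fderiv_eq]
    simp

theorem IsAnnular.continuous_comp_mul {B : E → ℂ} (hB : IsAnnular B) (k : E) {m : ℝ → ℂ}
    (hm : Continuous m) : Continuous fun y => m (radialComponent k y) * B y := by
  rw [continuous_iff_continuousAt]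
  intro y
  rcases lt_or_ge ‖y‖ 1 with h | h
  · refine (continuousAt_const (y := (0 : ℂ))).congr ?_
    filter_upwards [eventually_norm_lt_one h] with z hz
    simp [hB.eq_zero_of_lt z hz]
  · have : y ≠ 0 := norm_pos_iff.1 (by linarith)
    exact (hm.continuousAt.comp (continuousAt_radialComponent k this)).mul
      hB.contDiff.continuous.continuousAt

variable [FiniteDimensional ℝ E] [MeasurableSpace E] [BorelSpace E]

theorem IsAnnular.integrable_comp_mul {B : E → ℂ} (hB : IsAnnular B) (k : E) {m : ℝ → ℂ}
    (hm : Continuous m) : Integrable fun y => m (radialComponent k y) * B y := by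
  refine (hB.continuous_comp_mul k hm).integrable_of_hasCompactSupport ?_
  refine HasCompactSupport.intro (isCompact_closedBall (0 : E) 2) fun y hy => ?_
  rw [hB.eq_zero_of_gt y (by simpa using hy), mul_zero]

/-- Integration by parts against a function of the radial component. -/
theorem IsAnnular.integral_radialDeriv {B : E → ℂ} (hB : IsAnnular B) (k : E) {m m' : ℝ → ℂ}
    (hm : ∀ l, HasDerivAt m (m' l) l) (hm' : Continuous m') :
    ∫ y, m (radialComponent k y) * TorusFlow.radialDeriv k B y =
      -∫ y, m' (radialComponent k y) * ((‖k‖ ^ 2 - radialComponent k y ^ 2 : ℝ) : ℂ) * B y := by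
  have hmc : Continuous m := continuous_iff_continuousAt.2 fun l => (hm l).continuousAt
  set q : ℝ → ℂ := fun l => m' l * ((‖k‖ ^ 2 - l ^ 2 : ℝ) : ℂ) with hq
  have hqc : Continuous q := by fun_prop
  have hd (y : E) : HasLineDerivAt ℝ (fun y => m (radialComponent k y) * (‖y‖ • B y))
      (q (radialComponent k y) * B y +
        m (radialComponent k y) * TorusFlow.radialDeriv k B y) y k := by
    -- The radial component may fail to be differentiable at the origin, but `B` vanishes on the
    -- whole unit ball.
    rcases lt_or_ge ‖y‖ 1 with h | h
    · rw [hB.eq_zero_of_lt y h, (hB.radialDeriv k).eq_zero_of_lt y h]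
      have h0 : HasFDerivAt (fun y => m (radialComponent k y) * (‖y‖ • B y)) (0 : E →L[ℝ] ℂ) y := by
        refine (hasFDerivAt_const (0 : ℂ) y).congr_of_eventuallyEq ?_
        filter_upwards [eventually_norm_lt_one h] with z hz
        simp [hB.eq_zero_of_lt z hz]
      simpa using h0.hasLineDerivAt k
    · have hy : y ≠ 0 := norm_pos_iff.1 (by linarith)
      have hy' : ‖y‖ ≠ 0 := norm_ne_zero_iff.2 hy
      have h1 := hasLineDerivAt_radialComponent k hy
      have h2 : HasLineDerivAt ℝ (fun y => ‖y‖ • B y) (TorusFlow.radialDeriv k B y) y k :=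
        ((hB.norm_smul.contDiff.differentiable (by simp) y).hasFDerivAt).hasLineDerivAt k
      unfold HasLineDerivAt at h1 h2 ⊢
      have h4 := (hm (radialComponent k (y + (0 : ℝ) • k))).scomp (0 : ℝ) h1
      have h3 := h4.mul h2
      refine h3.congr_deriv ?_
      have hy'' : (‖y‖ : ℂ) ≠ 0 := by exact_mod_cast hy'
      simp only [hq, Complex.real_smul, Function.comp_apply, zero_smul, add_zero]
      push_cast
      field_simp
  have hi1 := hB.integrable_comp_mul k hqc
  have hi2 := (hB.radialDeriv k).integrable_comp_mul k hmc
  have hi3 := hB.norm_smul.integrable_comp_mul k hmc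
  -- Pairing with the constant 1 says that the integral of the directional derivative is zero.
  have := integral_bilinear_hasLineDerivAt_right_eq_neg_left_of_integrable
    (μ := (volume : Measure E)) (f := fun _ : E => (1 : ℂ)) (f' := fun _ => 0)
    (g := fun y => m (radialComponent k y) * (‖y‖ • B y)) (v := k)
    (B := ContinuousLinearMap.mul ℝ ℂ) (by simp) (by simpa [Pi.add_def] using hi1.add hi2)
    (by simpa using hi3)
    (fun x _ => by simpa using (hasFDerivAt_const (1 : ℂ) x).hasLineDerivAt k) (fun x _ => hd x)
  simp only [ContinuousLinearMap.mul_apply', one_mul, zero_mul, integral_zero, neg_zero] at this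
  rw [integral_add hi1 hi2] at this
  exact eq_neg_of_add_eq_zero_right this

end Oscillatory

end TorusFlow

namespace TorusFlow

/-! ### Cutoffs divided by powers of κ ∓ l -/

section Cutoff

/-- `χ⁽ʲ⁾(l) (κ - l)⁻ᵖ (κ + l)⁻ᑫ`. -/
noncomputable def cutoffResolvent (χ : ℝ → ℝ) (κ : ℝ) (j p q : ℕ) (l : ℝ) : ℝ :=
  iteratedDeriv j χ l * (((κ - l) ^ p)⁻¹ * ((κ + l) ^ q)⁻¹)

variable {χ : ℝ → ℝ} {κ δ : ℝ}

theorem iteratedDeriv_eq_zero_of_notMem_tsupport (j : ℕ) {l : ℝ} (hl : l ∉ tsupport χ) :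
    iteratedDeriv j χ l = 0 := by
  have := (notMem_tsupport_iff_eventuallyEq.1 hl).iteratedDeriv_eq j
  rw [this]
  change iteratedDeriv j (fun _ => (0 : ℝ)) l = 0
  simp

theorem cutoffResolvent_eq_zero_of_notMem_tsupport (κ : ℝ) (j p q : ℕ) {l : ℝ}
    (hl : l ∉ tsupport χ) : cutoffResolvent χ κ j p q l = 0 := by
  rw [cutoffResolvent, iteratedDeriv_eq_zero_of_notMem_tsupport j hl, zero_mul]

theorem exists_abs_cutoffResolvent_le (hχ : ContDiff ℝ ∞ χ) (hχc : HasCompactSupport χ)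
    (hδ : 0 < δ) (j p q : ℕ) : ∃ C, 0 ≤ C ∧ ∀ κ : ℝ,
      (∀ l ∈ tsupport χ, δ ≤ |κ - l| ∧ δ ≤ |κ + l|) →
        ∀ l, |cutoffResolvent χ κ j p q l| ≤ C := by
  obtain ⟨C, hC⟩ := hχc.isCompact.exists_bound_of_continuousOn
    (hχ.continuous_iteratedDeriv j (by exact_mod_cast le_top)).continuousOn
  refine ⟨|C| * ((δ ^ p)⁻¹ * (δ ^ q)⁻¹), by positivity, fun κ hκ l => ?_⟩
  by_cases hl : l ∈ tsupport χ
  · obtain ⟨h1, h2⟩ := hκ l hl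
    rw [cutoffResolvent, abs_mul, abs_mul, abs_inv, abs_inv, abs_pow, abs_pow]
    exact mul_le_mul ((hC l hl).trans (le_abs_self C)) (by gcongr) (by positivity) (abs_nonneg C)
  · rw [cutoffResolvent_eq_zero_of_notMem_tsupport κ j p q hl, abs_zero]
    positivity

theorem sub_ne_zero_and_add_ne_zero (hδ : 0 < δ)
    (hκ : ∀ l ∈ tsupport χ, δ ≤ |κ - l| ∧ δ ≤ |κ + l|) {l : ℝ} (hl : l ∈ tsupport χ) :
    κ - l ≠ 0 ∧ κ + l ≠ 0 :=
  ⟨abs_pos.1 (hδ.trans_le (hκ l hl).1), abs_pos.1 (hδ.trans_le (hκ l hl).2)⟩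

/-- On the support of χ the denominators are nonzero and the product rule applies. Off the support
they may vanish, but the function is locally zero. The family is thus closed under differentiation.
-/
theorem hasDerivAt_cutoffResolvent (hδ : 0 < δ)
    (hκ : ∀ l ∈ tsupport χ, δ ≤ |κ - l| ∧ δ ≤ |κ + l|) (hχ : ContDiff ℝ ∞ χ) (j p q : ℕ) (l : ℝ) :
    HasDerivAt (cutoffResolvent χ κ j p q) (cutoffResolvent χ κ (j + 1) p q l +
      p * cutoffResolvent χ κ j (p + 1) q l - q * cutoffResolvent χ κ j p (q + 1) l) l := by
  by_cases hl : l ∈ tsupport χ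
  · obtain ⟨h1, h2⟩ := sub_ne_zero_and_add_ne_zero hδ hκ hl
    have d0 : HasDerivAt (iteratedDeriv j χ) (iteratedDeriv (j + 1) χ l) l := by
      rw [iteratedDeriv_succ]
      exact (hχ.differentiable_iteratedDeriv j (by exact_mod_cast WithTop.coe_lt_top _)
        |>.differentiableAt).hasDerivAt
    have d1 : HasDerivAt (fun l => ((κ - l) ^ p)⁻¹) (p * ((κ - l) ^ (p + 1))⁻¹) l := by
      have := (((hasDerivAt_id l).const_sub κ).pow p).inv (pow_ne_zero p h1)
      refine this.congr_deriv ?_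
      rcases p with _ | p
      · simp
      · simp only [id, Nat.cast_succ, Nat.add_sub_cancel, Pi.pow_apply]
        field_simp
        ring
    have d2 : HasDerivAt (fun l => ((κ + l) ^ q)⁻¹) (-(q * ((κ + l) ^ (q + 1))⁻¹)) l := by
      have := (((hasDerivAt_id l).const_add κ).pow q).inv (pow_ne_zero q h2)
      refine this.congr_deriv ?_
      rcases q with _ | q
      · simp
      · simp only [id, Nat.cast_succ, Nat.add_sub_cancel, Pi.pow_apply]
        field_simp
        ring
    refine (d0.mul (d1.mul d2)).congr_deriv ?_
    simp only [cutoffResolvent, Pi.mul_apply]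
    ring
  · have hz := cutoffResolvent_eq_zero_of_notMem_tsupport κ (hl := hl)
    rw [hz, hz, hz]
    have h0 : cutoffResolvent χ κ j p q =ᶠ[nhds l] fun _ => 0 := by
      filter_upwards [(isClosed_tsupport χ).isOpen_compl.mem_nhds hl] with z hz
      exact cutoffResolvent_eq_zero_of_notMem_tsupport κ j p q hz
    simpa using (hasDerivAt_const l (0 : ℝ)).congr_of_eventuallyEq h0

theorem continuous_cutoffResolvent (hδ : 0 < δ)
    (hκ : ∀ l ∈ tsupport χ, δ ≤ |κ - l| ∧ δ ≤ |κ + l|) (hχ : ContDiff ℝ ∞ χ) (j p q : ℕ) :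
    Continuous (cutoffResolvent χ κ j p q) :=
  continuous_iff_continuousAt.2 fun l => (hasDerivAt_cutoffResolvent hδ hκ hχ j p q l).continuousAt

theorem cutoffResolvent_succ_left_mul (hδ : 0 < δ)
    (hκ : ∀ l ∈ tsupport χ, δ ≤ |κ - l| ∧ δ ≤ |κ + l|) (j p q : ℕ) (l : ℝ) :
    cutoffResolvent χ κ j (p + 1) q l * (κ - l) = cutoffResolvent χ κ j p q l := by
  by_cases hl : l ∈ tsupport χ
  · obtain ⟨h1, -⟩ := sub_ne_zero_and_add_ne_zero hδ hκ hl
    simp only [cutoffResolvent, pow_succ, mul_inv]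
    field_simp
  · rw [cutoffResolvent_eq_zero_of_notMem_tsupport κ _ _ _ hl,
      cutoffResolvent_eq_zero_of_notMem_tsupport κ _ _ _ hl, zero_mul]

theorem cutoffResolvent_succ_right_mul (hδ : 0 < δ)
    (hκ : ∀ l ∈ tsupport χ, δ ≤ |κ - l| ∧ δ ≤ |κ + l|) (j p q : ℕ) (l : ℝ) :
    cutoffResolvent χ κ j p (q + 1) l * (κ + l) = cutoffResolvent χ κ j p q l := by
  by_cases hl : l ∈ tsupport χ
  · obtain ⟨-, h2⟩ := sub_ne_zero_and_add_ne_zero hδ hκ hl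
    simp only [cutoffResolvent, pow_succ, mul_inv]
    field_simp
  · rw [cutoffResolvent_eq_zero_of_notMem_tsupport κ _ _ _ hl,
      cutoffResolvent_eq_zero_of_notMem_tsupport κ _ _ _ hl, zero_mul]

end Cutoff

/-! ### Nonstationary phase -/

section OscillatoryIntegral

variable {E : Type*} [NormedAddCommGroup E] [InnerProductSpace ℝ E] [FiniteDimensional ℝ E]
  [MeasurableSpace E] [BorelSpace E] {χ : ℝ → ℝ} {δ : ℝ}

/-- Oscillatory integral with phase the radial component of `k`. -/
noncomputable def oscIntegral (χ : ℝ → ℝ) (k : E) (j p q : ℕ) (B : E → ℂ) (s : ℝ) : ℂ :=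
  ∫ y, Complex.exp (Complex.I * s * radialComponent k y) *
    (cutoffResolvent χ ‖k‖ j p q (radialComponent k y) : ℂ) * B y

/-- Integrate by parts with one extra power of each denominator: their product cancels the factor
‖k‖² - r² coming from the derivative of the radial component r. Differentiating the exponential
returns the original integral times is; the other terms differentiate χ, raise a denominator, or
differentiate `B`. -/
theorem mul_oscIntegral (hχ : ContDiff ℝ ∞ χ) (hδ : 0 < δ) {k : E}
    (hk : ∀ l ∈ tsupport χ, δ ≤ |‖k‖ - l| ∧ δ ≤ |‖k‖ + l|) {B : E → ℂ} (hB : IsAnnular B)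
    (j p q : ℕ) (s : ℝ) :
    Complex.I * s * oscIntegral χ k j p q B s = -(oscIntegral χ k (j + 1) p q B s +
      (p + 1) * oscIntegral χ k j (p + 1) q B s - (q + 1) * oscIntegral χ k j p (q + 1) B s +
      oscIntegral χ k j (p + 1) (q + 1) (radialDeriv k B) s) := by
  have hr (j p q : ℕ) := continuous_cutoffResolvent hδ hk hχ j p q
  have he : Continuous fun l : ℝ => Complex.exp (Complex.I * s * l) := by fun_prop
  set e : ℝ → ℂ := fun l => Complex.exp (Complex.I * s * l) with he_def
  have hc (j p q : ℕ) : Continuous fun l => e l * (cutoffResolvent χ ‖k‖ j p q l : ℂ) :=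
    he.mul (Complex.continuous_ofReal.comp (hr j p q))
  have hint (j p q : ℕ) := hB.integrable_comp_mul k (hc j p q)
  set r' : ℝ → ℝ := fun l => cutoffResolvent χ ‖k‖ (j + 1) (p + 1) (q + 1) l +
      (p + 1 : ℕ) * cutoffResolvent χ ‖k‖ j (p + 1 + 1) (q + 1) l -
      (q + 1 : ℕ) * cutoffResolvent χ ‖k‖ j (p + 1) (q + 1 + 1) l with hr'
  have hm (l : ℝ) : HasDerivAt (fun l => e l * (cutoffResolvent χ ‖k‖ j (p + 1) (q + 1) l : ℂ))
      (Complex.I * s * e l * cutoffResolvent χ ‖k‖ j (p + 1) (q + 1) l + e l * (r' l : ℂ)) l := by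
    have h1 : HasDerivAt e (Complex.I * s * e l) l := by
      have h := ((Complex.ofRealCLM.hasDerivAt (x := l)).const_mul (Complex.I * s)).cexp
      refine h.congr_deriv ?_
      simp [he_def]
      ring
    exact h1.mul (hasDerivAt_cutoffResolvent hδ hk hχ j (p + 1) (q + 1) l).ofReal_comp
  have hm' : Continuous fun l : ℝ => Complex.I * s * e l *
      cutoffResolvent χ ‖k‖ j (p + 1) (q + 1) l + e l * (r' l : ℂ) := by
    fun_prop
  have key := hB.integral_radialDeriv k hm hm'
  have hpt (y : E) : (Complex.I * s * e (radialComponent k y) *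
        cutoffResolvent χ ‖k‖ j (p + 1) (q + 1) (radialComponent k y) +
        e (radialComponent k y) * (r' (radialComponent k y) : ℂ)) *
        ((‖k‖ ^ 2 - radialComponent k y ^ 2 : ℝ) : ℂ) * B y =
      Complex.I * s * (e (radialComponent k y) *
        cutoffResolvent χ ‖k‖ j p q (radialComponent k y) * B y) +
      e (radialComponent k y) * cutoffResolvent χ ‖k‖ (j + 1) p q (radialComponent k y) * B y +
      (p + 1) * (e (radialComponent k y) *
        cutoffResolvent χ ‖k‖ j (p + 1) q (radialComponent k y) * B y) -
      (q + 1) * (e (radialComponent k y) *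
        cutoffResolvent χ ‖k‖ j p (q + 1) (radialComponent k y) * B y) := by
    have hb (j p q : ℕ) (l : ℝ) : cutoffResolvent χ ‖k‖ j (p + 1) (q + 1) l * (‖k‖ ^ 2 - l ^ 2) =
        cutoffResolvent χ ‖k‖ j p q l := by
      rw [← cutoffResolvent_succ_left_mul hδ hk j p q, ← cutoffResolvent_succ_right_mul hδ hk j _ q]
      ring
    have hr'' (l : ℝ) : r' l * (‖k‖ ^ 2 - l ^ 2) = cutoffResolvent χ ‖k‖ (j + 1) p q l +
        (p + 1) * cutoffResolvent χ ‖k‖ j (p + 1) q l -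
        (q + 1) * cutoffResolvent χ ‖k‖ j p (q + 1) l := by
      rw [← hb (j + 1) p q, ← hb j (p + 1) q, ← hb j p (q + 1), hr']
      push_cast
      ring
    rw [add_mul, mul_assoc _ (cutoffResolvent _ _ _ _ _ _ : ℂ), mul_assoc _ (r' _ : ℂ),
      ← Complex.ofReal_mul, ← Complex.ofReal_mul, hb, hr'']
    push_cast
    ring
  simp only [hpt] at key
  rw [integral_sub, integral_add, integral_add, integral_const_mul, integral_const_mul,
    integral_const_mul] at key
  · change oscIntegral χ k j (p + 1) (q + 1) (radialDeriv k B) s =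
      -(Complex.I * s * oscIntegral χ k j p q B s + oscIntegral χ k (j + 1) p q B s +
        (p + 1) * oscIntegral χ k j (p + 1) q B s -
        (q + 1) * oscIntegral χ k j p (q + 1) B s) at key
    rw [key]
    ring
  · exact (hint _ _ _).const_mul _
  · exact hint _ _ _
  · exact ((hint _ _ _).const_mul _).add (hint _ _ _)
  · exact (hint _ _ _).const_mul _
  · exact (((hint _ _ _).const_mul _).add (hint _ _ _)).add ((hint _ _ _).const_mul _)
  · exact (hint _ _ _).const_mul _

/-- Nonstationary phase: the oscillatory integral decays rapidly, uniformly in the frequency. -/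
theorem exists_pow_mul_norm_oscIntegral_le (hχ : ContDiff ℝ ∞ χ) (hχc : HasCompactSupport χ)
    (hδ : 0 < δ) (N j p q : ℕ) : ∃ C, 0 ≤ C ∧ ∀ (k : E) (B : E → ℂ) (M : ℝ),
      (∀ l ∈ tsupport χ, δ ≤ |‖k‖ - l| ∧ δ ≤ |‖k‖ + l|) → IsAnnular B →
      (∀ i ≤ N, ∀ y, ‖(radialDeriv k)^[i] B y‖ ≤ M) →
      ∀ s : ℝ, |s| ^ N * ‖oscIntegral χ k j p q B s‖ ≤ C * M := by
  induction N generalizing j p q with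
  | zero =>
    obtain ⟨C, hC0, hC⟩ := exists_abs_cutoffResolvent_le hχ hχc hδ j p q
    -- The ball of radius 2 contains the support of `B`, so its volume enters the constant, which
    -- does not depend on k.
    refine ⟨C * volume.real (Metric.closedBall (0 : E) 2), by positivity,
      fun k B M hk hB hM s => ?_⟩
    have hM' (y : E) : ‖B y‖ ≤ M := hM 0 le_rfl y
    rw [pow_zero, one_mul, oscIntegral, ← setIntegral_eq_integral_of_forall_compl_eq_zero
      (s := Metric.closedBall (0 : E) 2)]
    · refine (norm_setIntegral_le_of_norm_le_const (C := C * M)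
        measure_closedBall_lt_top fun y _ => ?_).trans_eq (by ring)
      have h1 : ‖Complex.exp (Complex.I * s * radialComponent k y)‖ = 1 := by
        rw [mul_assoc, mul_comm, ← Complex.ofReal_mul, Complex.norm_exp_ofReal_mul_I]
      rw [norm_mul, norm_mul, h1, one_mul, Complex.norm_real]
      exact mul_le_mul (hC _ hk _) (hM' y) (norm_nonneg _) hC0
    · intro y hy
      rw [hB.eq_zero_of_gt y (by simpa using hy), mul_zero]
  | succ N ih =>
    obtain ⟨C1, h1, hC1⟩ := ih (j + 1) p q
    obtain ⟨C2, h2, hC2⟩ := ih j (p + 1) q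
    obtain ⟨C3, h3, hC3⟩ := ih j p (q + 1)
    obtain ⟨C4, h4, hC4⟩ := ih j (p + 1) (q + 1)
    refine ⟨C1 + (p + 1) * C2 + (q + 1) * C3 + C4, by positivity, fun k B M hk hB hM s => ?_⟩
    have hM1 : ∀ i ≤ N, ∀ y, ‖(radialDeriv k)^[i] B y‖ ≤ M := fun i hi => hM i (by omega)
    -- Only this term spends a derivative of `B`; the bound at level N + 1 supplies it.
    have hM2 : ∀ i ≤ N, ∀ y, ‖(radialDeriv k)^[i] (radialDeriv k B) y‖ ≤ M :=
      fun i hi => hM (i + 1) (by omega)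
    have e1 := hC1 k B M hk hB hM1 s
    have e2 := hC2 k B M hk hB hM1 s
    have e3 := hC3 k B M hk hB hM1 s
    have e4 := hC4 k _ M hk (hB.radialDeriv k) hM2 s
    have e := congrArg norm (mul_oscIntegral hχ hδ hk hB j p q s)
    rw [norm_mul, norm_mul, Complex.norm_I, one_mul, Complex.norm_real, Real.norm_eq_abs,
      norm_neg] at e
    have np (p : ℕ) : ‖(p + 1 : ℂ)‖ = p + 1 := by
      exact_mod_cast Complex.norm_natCast (p + 1)
    have tri : |s| * ‖oscIntegral χ k j p q B s‖ ≤ ‖oscIntegral χ k (j + 1) p q B s‖ +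
        (p + 1) * ‖oscIntegral χ k j (p + 1) q B s‖ +
        (q + 1) * ‖oscIntegral χ k j p (q + 1) B s‖ +
        ‖oscIntegral χ k j (p + 1) (q + 1) (radialDeriv k B) s‖ := by
      rw [e, ← np p, ← np q, ← norm_mul, ← norm_mul]
      refine (norm_add_le _ _).trans (add_le_add_left ((norm_sub_le _ _).trans
        (add_le_add_left (norm_add_le _ _) _)) _)
    calc |s| ^ (N + 1) * ‖oscIntegral χ k j p q B s‖
        = |s| ^ N * (|s| * ‖oscIntegral χ k j p q B s‖) := by ring
      _ ≤ |s| ^ N * (‖oscIntegral χ k (j + 1) p q B s‖ +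
        (p + 1) * ‖oscIntegral χ k j (p + 1) q B s‖ +
        (q + 1) * ‖oscIntegral χ k j p (q + 1) B s‖ +
        ‖oscIntegral χ k j (p + 1) (q + 1) (radialDeriv k B) s‖) := by gcongr
      _ = |s| ^ N * ‖oscIntegral χ k (j + 1) p q B s‖ +
        (p + 1) * (|s| ^ N * ‖oscIntegral χ k j (p + 1) q B s‖) +
        (q + 1) * (|s| ^ N * ‖oscIntegral χ k j p (q + 1) B s‖) +
        |s| ^ N * ‖oscIntegral χ k j (p + 1) (q + 1) (radialDeriv k B) s‖ := by ring
      _ ≤ C1 * M + (p + 1) * (C2 * M) + (q + 1) * (C3 * M) + C4 * M := by gcongr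
      _ = _ := by ring

end OscillatoryIntegral

end TorusFlow

namespace TorusFlow

/-! ### Fourier coefficients along the torus -/

section TorusFourier

/-- The Euclidean space `ℝᵈ`. -/
abbrev Euc (d : ℕ) : Type := EuclideanSpace ℝ (Fin d)

variable {d : ℕ}

/-- The projection `ℝᵈ → ℝᵈ / ℤᵈ`. -/
noncomputable def unitProj (d : ℕ) (x : Euc d) : UnitAddTorus (Fin d) :=
  fun i => (x i : UnitAddCircle)

theorem isOpenQuotientMap_unitProj (d : ℕ) : IsOpenQuotientMap (unitProj d) := by
  have h : IsOpenQuotientMap (fun (x : Fin d → ℝ) (i : Fin d) => (x i : UnitAddCircle)) :=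
    IsOpenQuotientMap.piMap fun _ => QuotientAddGroup.isOpenQuotientMap_mk
  exact h.comp (EuclideanSpace.equiv (Fin d) ℝ).toHomeomorph.isOpenQuotientMap

theorem unitProj_add (x y : Euc d) : unitProj d (x + y) = unitProj d x + unitProj d y := rfl

/-- The lattice vector in `ℝᵈ` with integer coordinates `k`. -/
noncomputable def latticeVec (k : Fin d → ℤ) : Euc d := WithLp.toLp 2 fun j => (k j : ℝ)

theorem mFourier_unitProj (k : Fin d → ℤ) (x : Euc d) : UnitAddTorus.mFourier k (unitProj d x) =
    Complex.exp (2 * Real.pi * Complex.I * (inner ℝ (latticeVec k) x : ℝ)) := by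
  simp only [UnitAddTorus.mFourier, ContinuousMap.coe_mk, unitProj, latticeVec,
    fourier_coe_apply, PiLp.inner_apply]
  rw [← Complex.exp_sum]
  congr 1
  push_cast
  rw [Finset.mul_sum]
  refine Finset.sum_congr rfl fun j _ => ?_
  simp
  ring

theorem contDiff_mFourier_unitProj (k : Fin d → ℤ) :
    ContDiff ℝ ∞ fun x => UnitAddTorus.mFourier k (unitProj d x) := by
  simp only [mFourier_unitProj]
  have : ContDiff ℝ ∞ fun x : Euc d => ((inner ℝ (latticeVec k) x : ℝ) : ℂ) :=
    Complex.ofRealCLM.contDiff.comp (contDiff_const.inner ℝ contDiff_id)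
  exact (contDiff_const.mul this).cexp

/-- Functions on `(ℝᵈ / ℤᵈ) × ℝᵈ` that are smooth and supported in `1 ≤ ‖y‖ ≤ 2`. -/
structure IsTorusAnnular (q : UnitAddTorus (Fin d) → Euc d → ℂ) : Prop where
  contDiff : ContDiff ℝ ∞ fun a : Euc d × Euc d => q (unitProj d a.1) a.2
  eq_zero_of_lt : ∀ u y, ‖y‖ < 1 → q u y = 0
  eq_zero_of_gt : ∀ u y, 2 < ‖y‖ → q u y = 0

/-- Fourier coefficients with respect to the torus variable. -/
noncomputable def torusCoeff (q : UnitAddTorus (Fin d) → Euc d → ℂ) (k : Fin d → ℤ) (y : Euc d) :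
    ℂ :=
  UnitAddTorus.mFourierCoeff (fun u => q u y) k

/-- The Haar probability measure of `ℝᵈ / ℤᵈ`. -/
noncomputable def torusHaar (d : ℕ) : Measure (UnitAddTorus (Fin d)) :=
  Measure.pi fun _ => AddCircle.haarAddCircle

instance isProbabilityMeasureTorusHaar (d : ℕ) : IsProbabilityMeasure (torusHaar d) := by
  unfold torusHaar; infer_instance

instance isAddHaarMeasureTorusHaar (d : ℕ) : (torusHaar d).IsAddHaarMeasure := by
  unfold torusHaar; infer_instance

theorem torusCoeff_eq (q : UnitAddTorus (Fin d) → Euc d → ℂ) (k : Fin d → ℤ) (y : Euc d) :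
    torusCoeff q k y = ∫ u, UnitAddTorus.mFourier (-k) u * q u y ∂(torusHaar d) := rfl

/-- The derivative of `q` along the torus in the direction `v`. -/
noncomputable def torusDeriv (v : Euc d) (q : UnitAddTorus (Fin d) → Euc d → ℂ)
    (u : UnitAddTorus (Fin d)) (y : Euc d) : ℂ :=
  fderiv ℝ (fun x => q (u + unitProj d x) y) 0 v

variable {q : UnitAddTorus (Fin d) → Euc d → ℂ}

namespace IsTorusAnnular

theorem continuous_uncurry (hq : IsTorusAnnular q) : Continuous (Function.uncurry q) :=
  continuous_uncurry_of_lift (isOpenQuotientMap_unitProj d) hq.contDiff.continuous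

theorem continuous_left (hq : IsTorusAnnular q) (y : Euc d) : Continuous fun u => q u y :=
  hq.continuous_uncurry.comp (by fun_prop : Continuous fun u => (u, y))

theorem integrable_mFourier_mul (hq : IsTorusAnnular q) (k : Fin d → ℤ) (y : Euc d) :
    Integrable (fun u => UnitAddTorus.mFourier k u * q u y) (torusHaar d) :=
  (((UnitAddTorus.mFourier k).continuous.mul
    (hq.continuous_left y))).integrable_of_hasCompactSupport (HasCompactSupport.of_compactSpace _)

theorem isAnnular (hq : IsTorusAnnular q) (u : UnitAddTorus (Fin d)) : IsAnnular (q u) where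
  contDiff := by
    obtain ⟨x, rfl⟩ := (isOpenQuotientMap_unitProj d).surjective u
    exact hq.contDiff.comp ((contDiff_const (c := x)).prodMk contDiff_id)
  eq_zero_of_lt := hq.eq_zero_of_lt u
  eq_zero_of_gt := hq.eq_zero_of_gt u

theorem isAnnular_torusCoeff (hq : IsTorusAnnular q) (k : Fin d → ℤ) :
    IsAnnular (torusCoeff q k) where
  contDiff := contDiff_integral_of_lift (μ := torusHaar d) (isOpenQuotientMap_unitProj d)
    (g := fun u y => UnitAddTorus.mFourier (-k) u * q u y)
    (((contDiff_mFourier_unitProj (-k)).comp contDiff_fst).mul hq.contDiff)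
  eq_zero_of_lt y hy := by simp [torusCoeff_eq, hq.eq_zero_of_lt _ y hy]
  eq_zero_of_gt y hy := by simp [torusCoeff_eq, hq.eq_zero_of_gt _ y hy]

theorem torusDeriv (hq : IsTorusAnnular q) (v : Euc d) : IsTorusAnnular (torusDeriv v q) where
  contDiff := by
    have h (a : Euc d × Euc d) : TorusFlow.torusDeriv v q (unitProj d a.1) a.2 =
        fderiv ℝ (fun a : Euc d × Euc d => q (unitProj d a.1) a.2) a (v, 0) := by
      have h1 := (hq.contDiff.differentiable (by simp) a).hasFDerivAt
      have h2 : HasFDerivAt (fun x : Euc d => (a.1 + x, a.2))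
          (ContinuousLinearMap.inl ℝ _ _) 0 := by
        exact ((hasFDerivAt_id (0 : Euc d)).const_add a.1).prodMk (hasFDerivAt_const a.2 0)
      have h3 : HasFDerivAt (fun x : Euc d => q (unitProj d (a.1 + x)) a.2) _ 0 :=
        HasFDerivAt.comp (g := fun a : Euc d × Euc d => q (unitProj d a.1) a.2) 0
          (by simpa using h1) h2
      rw [TorusFlow.torusDeriv]
      simp only [← unitProj_add]
      rw [h3.fderiv]
      simp
    simp only [h]
    exact (hq.contDiff.fderiv_right (by simp)).clm_apply contDiff_const
  eq_zero_of_lt u y hy := by simp [TorusFlow.torusDeriv, hq.eq_zero_of_lt _ y hy]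
  eq_zero_of_gt u y hy := by simp [TorusFlow.torusDeriv, hq.eq_zero_of_gt _ y hy]

theorem radialDeriv (hq : IsTorusAnnular q) (v : Euc d) :
    IsTorusAnnular fun u => radialDeriv v (q u) where
  contDiff := by
    have h := contDiff_norm_smul hq.contDiff fun a => hq.eq_zero_of_lt _ a.2
    exact (contDiff_fderiv_of_lift (p := unitProj d) (g := fun u (y : Euc d) => ‖y‖ • q u y)
      h).clm_apply contDiff_const
  eq_zero_of_lt u := ((hq.isAnnular u).radialDeriv v).eq_zero_of_lt
  eq_zero_of_gt u := ((hq.isAnnular u).radialDeriv v).eq_zero_of_gt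

theorem const_mul (hq : IsTorusAnnular q) (c : ℂ) : IsTorusAnnular fun u y => c * q u y where
  contDiff := contDiff_const.mul hq.contDiff
  eq_zero_of_lt u y hy := by rw [hq.eq_zero_of_lt u y hy, mul_zero]
  eq_zero_of_gt u y hy := by rw [hq.eq_zero_of_gt u y hy, mul_zero]

theorem sum {ι : Type*} {s : Finset ι} {q : ι → UnitAddTorus (Fin d) → Euc d → ℂ}
    (hq : ∀ i, IsTorusAnnular (q i)) : IsTorusAnnular fun u y => ∑ i ∈ s, q i u y where
  contDiff := ContDiff.sum fun i _ => (hq i).contDiff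
  eq_zero_of_lt u y hy := Finset.sum_eq_zero fun i _ => (hq i).eq_zero_of_lt u y hy
  eq_zero_of_gt u y hy := Finset.sum_eq_zero fun i _ => (hq i).eq_zero_of_gt u y hy

theorem torusCoeff_const_mul (c : ℂ) (k : Fin d → ℤ) (y : Euc d) :
    torusCoeff (fun u y => c * q u y) k y = c * torusCoeff q k y := by
  rw [torusCoeff_eq, torusCoeff_eq, ← integral_const_mul]
  simp only [mul_left_comm]

theorem torusCoeff_sum {ι : Type*} {s : Finset ι} {q : ι → UnitAddTorus (Fin d) → Euc d → ℂ}
    (hq : ∀ i, IsTorusAnnular (q i)) (k : Fin d → ℤ) (y : Euc d) :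
    torusCoeff (fun u y => ∑ i ∈ s, q i u y) k y = ∑ i ∈ s, torusCoeff (q i) k y := by
  simp only [torusCoeff_eq, Finset.mul_sum]
  exact integral_finsetSum _ fun i _ => (hq i).integrable_mFourier_mul (-k) y

/-- The character does not involve y, so the y-derivative passes through the integral over the
torus. -/
theorem torusCoeff_radialDeriv (hq : IsTorusAnnular q) (v : Euc d) (k : Fin d → ℤ) :
    torusCoeff (fun u => TorusFlow.radialDeriv v (q u)) k =
      TorusFlow.radialDeriv v (torusCoeff q k) := by
  funext y
  have h := integral_fderiv_apply_of_lift (μ := torusHaar d) (isOpenQuotientMap_unitProj d)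
    (g := fun u (y : Euc d) => UnitAddTorus.mFourier (-k) u * (‖y‖ • q u y))
    (((contDiff_mFourier_unitProj (-k)).comp contDiff_fst).mul
      (contDiff_norm_smul hq.contDiff fun a => hq.eq_zero_of_lt _ a.2)) y v
  rw [torusCoeff_eq, TorusFlow.radialDeriv]
  convert! h using 1
  · refine integral_congr_ae (Filter.Eventually.of_forall fun u => ?_)
    have := ((hq.isAnnular u).norm_smul.contDiff.differentiable (by simp) y)
    simp only [TorusFlow.radialDeriv]
    rw [fderiv_const_mul this]
    rfl
  · congr 2
    funext y
    rw [torusCoeff_eq, ← integral_smul]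
    simp only [mul_smul_comm]

/-- By invariance of Haar measure, translating q by x multiplies its k-th coefficient by e^{2πi
k·x}; differentiate at x = 0. -/
theorem torusCoeff_torusDeriv (hq : IsTorusAnnular q) (v : Euc d) (k : Fin d → ℤ) (y : Euc d) :
    torusCoeff (TorusFlow.torusDeriv v q) k y =
      2 * Real.pi * Complex.I * (inner ℝ (latticeVec k) v : ℝ) * torusCoeff q k y := by
  have hl : ContDiff ℝ ∞ fun a : Euc d × Euc d => q (unitProj d a.1 + unitProj d a.2) y :=
    hq.contDiff.comp ((contDiff_fst.add contDiff_snd).prodMk (contDiff_const (c := y)))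
  have h := integral_fderiv_apply_of_lift (μ := torusHaar d) (isOpenQuotientMap_unitProj d)
    (g := fun u x => UnitAddTorus.mFourier (-k) u * q (u + unitProj d x) y)
    (((contDiff_mFourier_unitProj (-k)).comp contDiff_fst).mul hl) 0 v
  have h1 (x : Euc d) : ∫ u, UnitAddTorus.mFourier (-k) u * q (u + unitProj d x) y ∂(torusHaar d) =
      Complex.exp (2 * Real.pi * Complex.I * (inner ℝ (latticeVec k) x : ℝ)) *
        torusCoeff q k y := by
    rw [← integral_sub_right_eq_self _ (unitProj d x), torusCoeff_eq, ← integral_const_mul,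
      ← mFourier_unitProj]
    refine integral_congr_ae (Filter.Eventually.of_forall fun u => ?_)
    have : UnitAddTorus.mFourier (-k) (u - unitProj d x) =
        UnitAddTorus.mFourier k (unitProj d x) * UnitAddTorus.mFourier (-k) u := by
      simp [UnitAddTorus.mFourier, ← Finset.prod_mul_distrib, fourier_apply, sub_eq_add_neg,
        AddCircle.toCircle_add, smul_add, mul_comm]
    simp only [sub_add_cancel, this, mul_assoc]
  have h2 : HasFDerivAt (fun x : Euc d => Complex.exp (2 * Real.pi * Complex.I *
      (inner ℝ (latticeVec k) x : ℝ)) * torusCoeff q k y)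
      ((2 * Real.pi * Complex.I * torusCoeff q k y) •
        (Complex.ofRealCLM.comp (innerSL ℝ (latticeVec k)))) 0 := by
    have h3 : HasFDerivAt (fun x : Euc d => ((inner ℝ (latticeVec k) x : ℝ) : ℂ))
        (Complex.ofRealCLM.comp (innerSL ℝ (latticeVec k))) 0 :=
      (Complex.ofRealCLM.comp (innerSL ℝ (latticeVec k))).hasFDerivAt
    refine ((h3.const_mul (2 * Real.pi * Complex.I)).cexp.mul_const (torusCoeff q k y)).congr_fderiv
      ?_
    ext x
    simp
    ring
  simp only [h1, h2.fderiv] at h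
  rw [torusCoeff_eq]
  convert! h using 1
  · refine integral_congr_ae (Filter.Eventually.of_forall fun u => ?_)
    obtain ⟨x, rfl⟩ := (isOpenQuotientMap_unitProj d).surjective u
    have : DifferentiableAt ℝ (fun z => q (unitProj d x + unitProj d z) y) 0 :=
      (hl.comp ((contDiff_const (c := x)).prodMk contDiff_id)).differentiable (by simp) 0
    simp only [TorusFlow.torusDeriv]
    rw [fderiv_const_mul this]
    rfl
  · simp
    ring

end IsTorusAnnular

end TorusFourier

end TorusFlow

namespace TorusFlow

/-! ### Summability of the coefficients and their radial derivatives -/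

section RapidDecay

variable {d : ℕ}

/-- The standard basis vectors of `ℝᵈ`. -/
noncomputable def stdVec (j : Fin d) : Euc d := EuclideanSpace.single j 1

theorem inner_latticeVec_stdVec (k : Fin d → ℤ) (j : Fin d) :
    (inner ℝ (latticeVec k) (stdVec j) : ℝ) = k j := by
  rw [stdVec, EuclideanSpace.inner_single_right]
  simp [latticeVec]

theorem sum_smul_stdVec (k : Fin d → ℤ) : ∑ j, (k j : ℝ) • stdVec j = latticeVec k := by
  ext i
  simp [latticeVec, stdVec, Pi.single_apply]

/-- The operator `(2πi)⁻¹ ∇ᵤ · ∇_y ‖y‖`, acting as `radialDeriv` on Fourier coefficients. -/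
noncomputable def crossOp (q : UnitAddTorus (Fin d) → Euc d → ℂ) (u : UnitAddTorus (Fin d))
    (y : Euc d) : ℂ :=
  (2 * Real.pi * Complex.I)⁻¹ *
    ∑ j, torusDeriv (stdVec j) (fun u => radialDeriv (stdVec j) (q u)) u y

/-- The rescaled Laplacian `-(2π)⁻² Δᵤ`, acting as `‖k‖²` on Fourier coefficients. -/
noncomputable def laplaceOp (q : UnitAddTorus (Fin d) → Euc d → ℂ) (u : UnitAddTorus (Fin d))
    (y : Euc d) : ℂ :=
  ((2 * Real.pi * Complex.I)⁻¹) ^ 2 *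
    ∑ j, torusDeriv (stdVec j) (torusDeriv (stdVec j) q) u y

variable {q : UnitAddTorus (Fin d) → Euc d → ℂ}

theorem IsTorusAnnular.crossOp (hq : IsTorusAnnular q) : IsTorusAnnular (crossOp q) :=
  (IsTorusAnnular.sum fun j => (hq.radialDeriv (stdVec j)).torusDeriv (stdVec j)).const_mul _

theorem IsTorusAnnular.laplaceOp (hq : IsTorusAnnular q) : IsTorusAnnular (laplaceOp q) :=
  (IsTorusAnnular.sum fun j => (hq.torusDeriv (stdVec j)).torusDeriv (stdVec j)).const_mul _

/-- Write k = ∑ kⱼ eⱼ and trade each kⱼ for (2πi)⁻¹ ∂/∂uⱼ. The k-dependent operator on coefficients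
thus comes from a single operator on functions, independent of k. -/
theorem IsTorusAnnular.torusCoeff_crossOp (hq : IsTorusAnnular q) (k : Fin d → ℤ) :
    torusCoeff (TorusFlow.crossOp q) k = TorusFlow.radialDeriv (latticeVec k) (torusCoeff q k) := by
  funext y
  unfold TorusFlow.crossOp
  rw [torusCoeff_const_mul, torusCoeff_sum fun j =>
    (hq.radialDeriv (stdVec j)).torusDeriv (stdVec j)]
  simp only [(hq.radialDeriv _).torusCoeff_torusDeriv, inner_latticeVec_stdVec,
    hq.torusCoeff_radialDeriv, mul_assoc (2 * Real.pi * Complex.I : ℂ)]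
  rw [← Finset.mul_sum, inv_mul_cancel_left₀ Complex.two_pi_I_ne_zero]
  unfold TorusFlow.radialDeriv
  rw [← sum_smul_stdVec, map_sum]
  simp

theorem IsTorusAnnular.torusCoeff_laplaceOp (hq : IsTorusAnnular q) (k : Fin d → ℤ) (y : Euc d) :
    torusCoeff (TorusFlow.laplaceOp q) k y = ‖latticeVec k‖ ^ 2 * torusCoeff q k y := by
  unfold TorusFlow.laplaceOp
  rw [torusCoeff_const_mul, torusCoeff_sum fun j => (hq.torusDeriv (stdVec j)).torusDeriv _]
  simp only [(hq.torusDeriv _).torusCoeff_torusDeriv, hq.torusCoeff_torusDeriv,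
    inner_latticeVec_stdVec]
  have h : (‖latticeVec k‖ ^ 2 : ℂ) = ∑ j, (k j : ℂ) ^ 2 := by
    rw [← Complex.ofReal_pow, EuclideanSpace.norm_sq_eq]
    simp [latticeVec]
  rw [h, Finset.mul_sum, Finset.sum_mul]
  refine Finset.sum_congr rfl fun j _ => ?_
  have := Complex.two_pi_I_ne_zero
  push_cast
  rw [inv_pow, inv_mul_eq_iff_eq_mul₀ (pow_ne_zero 2 this)]
  ring

theorem IsTorusAnnular.iterate_crossOp (hq : IsTorusAnnular q) (i : ℕ) :
    IsTorusAnnular (TorusFlow.crossOp^[i] q) := by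
  induction i with
  | zero => exact hq
  | succ i ih =>
    rw [Function.iterate_succ_apply']
    exact ih.crossOp

theorem IsTorusAnnular.iterate_laplaceOp (hq : IsTorusAnnular q) (i : ℕ) :
    IsTorusAnnular (TorusFlow.laplaceOp^[i] q) := by
  induction i with
  | zero => exact hq
  | succ i ih =>
    rw [Function.iterate_succ_apply']
    exact ih.laplaceOp

theorem IsTorusAnnular.torusCoeff_iterate_crossOp (hq : IsTorusAnnular q) (i : ℕ)
    (k : Fin d → ℤ) : torusCoeff (TorusFlow.crossOp^[i] q) k =
      (TorusFlow.radialDeriv (latticeVec k))^[i] (torusCoeff q k) := by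
  induction i with
  | zero => rfl
  | succ i ih =>
    rw [Function.iterate_succ_apply', Function.iterate_succ_apply',
      (hq.iterate_crossOp i).torusCoeff_crossOp, ih]

theorem IsTorusAnnular.torusCoeff_iterate_laplaceOp (hq : IsTorusAnnular q) (i : ℕ)
    (k : Fin d → ℤ) (y : Euc d) : torusCoeff (TorusFlow.laplaceOp^[i] q) k y =
      (‖latticeVec k‖ ^ 2) ^ i * torusCoeff q k y := by
  induction i with
  | zero => simp
  | succ i ih =>
    rw [Function.iterate_succ_apply', (hq.iterate_laplaceOp i).torusCoeff_laplaceOp, ih, pow_succ]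
    ring

theorem IsTorusAnnular.exists_norm_le (hq : IsTorusAnnular q) : ∃ C, ∀ u y, ‖q u y‖ ≤ C := by
  obtain ⟨C, hC⟩ := (isCompact_univ.prod
    (isCompact_closedBall (0 : Euc d) 2)).exists_bound_of_continuousOn
    hq.continuous_uncurry.continuousOn
  refine ⟨|C|, fun u y => ?_⟩
  rcases le_or_gt ‖y‖ 2 with h | h
  · exact (hC (u, y) ⟨mem_univ _, by simpa using h⟩).trans (le_abs_self C)
  · rw [hq.eq_zero_of_gt u y h, norm_zero]
    exact abs_nonneg C

theorem norm_mFourier_apply (k : Fin d → ℤ) (u : UnitAddTorus (Fin d)) :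
    ‖UnitAddTorus.mFourier k u‖ = 1 := by
  simp only [UnitAddTorus.mFourier, fourier_apply, ContinuousMap.coe_mk, norm_prod,
    Circle.norm_coe, Finset.prod_const_one]

theorem IsTorusAnnular.exists_norm_torusCoeff_le (hq : IsTorusAnnular q) :
    ∃ C, ∀ k y, ‖torusCoeff q k y‖ ≤ C := by
  obtain ⟨C, hC⟩ := hq.exists_norm_le
  refine ⟨C, fun k y => ?_⟩
  rw [torusCoeff_eq]
  refine (norm_integral_le_of_norm_le_const (C := C)
    (Filter.Eventually.of_forall fun u => ?_)).trans_eq (by simp)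
  rw [norm_mul, norm_mFourier_apply, one_mul]
  exact hC u y

theorem latticeVec_injective : Function.Injective (latticeVec (d := d)) := fun k l h => by
  funext j
  have := congrArg (fun v : Euc d => v j) h
  simpa [latticeVec] using this

theorem latticeVec_eq_zero {k : Fin d → ℤ} : latticeVec k = 0 ↔ k = 0 := by
  rw [← latticeVec_injective.eq_iff]
  have : latticeVec (0 : Fin d → ℤ) = 0 := by ext; simp [latticeVec]
  rw [this]

/-- The lattice is the ℤ-span of the standard basis, of rank d; the sum of inverse powers converges
once the exponent exceeds the rank. -/
theorem exists_submodule_summable_norm_inv_pow (n : ℕ) (hn : d < n) :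
    ∃ L : Submodule ℤ (Euc d), (∀ j, stdVec j ∈ L) ∧ Summable fun z : L => ‖(z : Euc d)‖⁻¹ ^ n := by
  refine ⟨Submodule.span ℤ (range (EuclideanSpace.basisFun (Fin d) ℝ).toBasis), fun j => ?_, ?_⟩
  · refine Submodule.subset_span ⟨j, ?_⟩
    rw [OrthonormalBasis.coe_toBasis, EuclideanSpace.basisFun_apply, stdVec]
  · refine ZLattice.summable_norm_pow_inv _ n ?_
    rw [ZLattice.rank ℝ]
    simpa using hn

theorem summable_norm_latticeVec_inv_pow (n : ℕ) (hn : d < n) :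
    Summable fun k : Fin d → ℤ => ‖latticeVec k‖⁻¹ ^ n := by
  obtain ⟨L, hL, hs⟩ := exists_submodule_summable_norm_inv_pow (d := d) n hn
  have hmem (k : Fin d → ℤ) : latticeVec k ∈ L := by
    rw [← sum_smul_stdVec]
    refine Submodule.sum_mem _ fun j _ => ?_
    rw [Int.cast_smul_eq_zsmul]
    exact zsmul_mem (hL j) (k j)
  have hi : Function.Injective fun k : Fin d → ℤ => (⟨latticeVec k, hmem k⟩ : L) :=
    fun k l h => latticeVec_injective (congrArg (fun z : L => (z : Euc d)) h)
  have h := hs.comp_injective hi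
  simp only [Function.comp_def] at h
  exact h

theorem IsTorusAnnular.exists_summable_norm_torusCoeff_le (hq : IsTorusAnnular q) :
    ∃ M : (Fin d → ℤ) → ℝ, Summable M ∧ ∀ k y, ‖torusCoeff q k y‖ ≤ M k := by
  obtain ⟨C0, h0⟩ := hq.exists_norm_torusCoeff_le
  obtain ⟨C1, h1⟩ := (hq.iterate_laplaceOp (d + 1)).exists_norm_torusCoeff_le
  -- Applying `laplaceOp` d + 1 times gains ‖k‖^{-2(d+1)}, and 2(d+1) > d. At k = 0 the first term
  -- is zero by the convention 0⁻¹ = 0, so that coefficient gets its own bound.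
  refine ⟨fun k => C1 * ‖latticeVec k‖⁻¹ ^ (2 * (d + 1)) + if k = 0 then |C0| else 0, ?_, ?_⟩
  · refine ((summable_norm_latticeVec_inv_pow _ (by omega)).mul_left C1).add ?_
    exact summable_of_hasFiniteSupport ((finite_singleton (0 : Fin d → ℤ)).subset fun k hk => by
      by_contra h
      simp_all)
  · intro k y
    by_cases hk : k = 0
    · subst hk
      have : latticeVec (0 : Fin d → ℤ) = 0 := latticeVec_eq_zero.2 rfl
      simpa [this] using (h0 0 y).trans (le_abs_self C0)
    · have hpos : 0 < ‖latticeVec k‖ := norm_pos_iff.2 (mt latticeVec_eq_zero.1 hk)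
      have := h1 k y
      rw [hq.torusCoeff_iterate_laplaceOp, norm_mul, norm_pow, norm_pow, Complex.norm_real,
        norm_norm, ← pow_mul] at this
      simp only [if_neg hk, add_zero]
      rw [ inv_pow, ← div_eq_mul_inv, le_div_iff₀ (by positivity), mul_comm]
      exact this

/-- The iterates are the coefficients of `crossOp^[i] q`, which is again smooth, so the growth in k
caused by differentiating along k is already accounted for. -/
theorem IsTorusAnnular.exists_summable_norm_iterate_le (hq : IsTorusAnnular q) (N : ℕ) :
    ∃ M : (Fin d → ℤ) → ℝ, Summable M ∧ ∀ k, ∀ i ≤ N, ∀ y,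
      ‖(TorusFlow.radialDeriv (latticeVec k))^[i] (torusCoeff q k) y‖ ≤ M k := by
  choose M hM hMk using fun i => (hq.iterate_crossOp i).exists_summable_norm_torusCoeff_le
  refine ⟨fun k => ∑ i ∈ Finset.range (N + 1), M i k, summable_sum fun i _ => hM i,
    fun k i hi y => ?_⟩
  rw [← hq.torusCoeff_iterate_crossOp]
  exact (hMk i k y).trans (Finset.single_le_sum (f := fun i => M i k)
    (fun j _ => (norm_nonneg _).trans (hMk j k y)) (Finset.mem_range.2 (by omega)))

theorem IsTorusAnnular.hasSum_torusCoeff (hq : IsTorusAnnular q) (u : UnitAddTorus (Fin d))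
    (y : Euc d) : HasSum (fun k => torusCoeff q k y * UnitAddTorus.mFourier k u) (q u y) := by
  obtain ⟨M, hM, hMk⟩ := hq.exists_summable_norm_torusCoeff_le
  let f : C(UnitAddTorus (Fin d), ℂ) := ⟨fun u => q u y, hq.continuous_left y⟩
  exact UnitAddTorus.hasSum_mFourier_series_apply_of_summable (f := f)
    (Summable.of_norm_bounded hM fun k => hMk k y) u

end RapidDecay

end TorusFlow

namespace TorusFlow

/-! ### Polar coordinates with a radial bump -/

section Polar

variable {n : ℕ}

theorem norm_stdVec {d : ℕ} (j : Fin d) : ‖stdVec j‖ = 1 := by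
  rw [stdVec, PiLp.norm_single]
  simp

/-- The direction `y / ‖y‖` of a nonzero vector. -/
noncomputable def sphereDir (y : Euc (n + 1)) : USphere (n + 1) :=
  if h : y = 0 then ⟨stdVec 0, by simp [norm_stdVec]⟩
  else ⟨‖y‖⁻¹ • y, by simp [norm_smul, h]⟩

theorem coe_sphereDir {y : Euc (n + 1)} (hy : y ≠ 0) :
    (sphereDir y : Euc (n + 1)) = ‖y‖⁻¹ • y := by
  rw [sphereDir, dif_neg hy]

theorem contMDiffAt_sphereDir {y : Euc (n + 1)} (hy : y ≠ 0) :
    ContMDiffAt 𝓘(ℝ, Euc (n + 1)) (𝓡 n) ∞ sphereDir y := by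
  have : Fact (Module.finrank ℝ (Euc (n + 1)) = n + 1) :=
    ⟨finrank_euclideanSpace_fin⟩
  -- Restricting the codomain to the sphere needs a globally smooth map of unit norm, so the
  -- argument runs on the open manifold of nonzero vectors.
  let U : TopologicalSpace.Opens (Euc (n + 1)) := ⟨{0}ᶜ, isOpen_compl_singleton⟩
  have h1 : ContMDiff 𝓘(ℝ, Euc (n + 1)) 𝓘(ℝ, Euc (n + 1)) ∞ fun u : U => ‖(u : Euc (n + 1))‖⁻¹ •
      (u : Euc (n + 1)) := by
    intro u
    have hu : (u : Euc (n + 1)) ≠ 0 := u.2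
    refine (contMDiffAt_subtype_iff (f := fun u : Euc (n + 1) => ‖u‖⁻¹ • u)).2 ?_
    exact (((contDiffAt_norm ℝ hu).inv (norm_ne_zero_iff.2 hu)).smul contDiffAt_id).contMDiffAt
  have h2 := h1.codRestrict_sphere (n := n) (fun u => by
    have hu : (u : Euc (n + 1)) ≠ 0 := u.2
    simp [norm_smul, hu])
  have h3 : ContMDiff 𝓘(ℝ, Euc (n + 1)) (𝓡 n) ∞ fun u : U => sphereDir (u : Euc (n + 1)) := by
    refine h2.congr fun u => Subtype.ext (coe_sphereDir u.2)
  exact contMDiffAt_subtype_iff.1 (h3 ⟨y, hy⟩)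

theorem IsSmooth.contDiffAt_comp_sphereDir {φ : STorus (n + 1) → ℂ} (hφ : IsSmooth φ)
    {a : Euc (n + 1) × Euc (n + 1)} (ha : a.2 ≠ 0) : ContDiffAt ℝ ∞
      (fun a : Euc (n + 1) × Euc (n + 1) => φ (proj (n + 1) a.1, sphereDir a.2)) a := by
  rw [← contMDiffAt_iff_contDiffAt]
  have h1 : ContMDiffAt 𝓘(ℝ, Euc (n + 1) × Euc (n + 1)) (𝓡 n) ∞
      (fun a : Euc (n + 1) × Euc (n + 1) => sphereDir a.2) a :=
    ContMDiffAt.comp a (contMDiffAt_sphereDir ha) contDiff_snd.contMDiff.contMDiffAt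
  have h2 : ContMDiffAt 𝓘(ℝ, Euc (n + 1) × Euc (n + 1)) 𝓘(ℝ, Euc (n + 1)) ∞
      (fun a : Euc (n + 1) × Euc (n + 1) => a.1) a := contDiff_fst.contMDiff.contMDiffAt
  exact ContMDiffAt.comp a (f := fun a : Euc (n + 1) ×
    Euc (n + 1) => (a.1, sphereDir a.2)) (hφ (a.1, sphereDir a.2)) (h2.prodMk h1)

/-- A smooth radial cutoff supported in `1 < r < 2`. -/
noncomputable def radialBump : ContDiffBump (3 / 2 : ℝ) := ⟨1 / 4, 1 / 2, by norm_num, by norm_num⟩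

theorem radialBump_eq_zero_of_le {r : ℝ} (hr : r ≤ 1) : radialBump r = 0 := by
  refine radialBump.zero_of_le_dist ?_
  rw [Real.dist_eq, abs_sub_comm, abs_of_nonneg (by linarith)]
  change (1 / 2 : ℝ) ≤ _
  linarith

theorem radialBump_eq_zero_of_ge {r : ℝ} (hr : 2 ≤ r) : radialBump r = 0 := by
  refine radialBump.zero_of_le_dist ?_
  rw [Real.dist_eq, abs_of_nonneg (by linarith)]
  change (1 / 2 : ℝ) ≤ _
  linarith

/-- The normalization constant of `radialBump` in polar coordinates. -/
noncomputable def radialConst (n : ℕ) : ℂ :=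
  ∫ r : Ioi (0 : ℝ), ((radialBump (r : ℝ) : ℝ) : ℂ) ∂(Measure.volumeIoiPow n)

/-- Integration in polar coordinates against `radialBump`. -/
theorem integral_radialBump_mul (h : USphere (n + 1) → ℂ) :
    ∫ y : Euc (n + 1), ((radialBump ‖y‖ : ℝ) : ℂ) * h (sphereDir y) =
      (∫ θ, h θ ∂((volume : Measure (Euc (n + 1))).toSphere)) *
        radialConst n := by
  calc ∫ y : Euc (n + 1), ((radialBump ‖y‖ : ℝ) : ℂ) * h (sphereDir y)
      = ∫ y : ({(0)}ᶜ : Set (Euc (n + 1))), ((radialBump ‖(y : Euc (n + 1))‖ : ℝ) : ℂ) *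
          h (sphereDir (y : Euc (n + 1))) ∂(volume.comap Subtype.val) := by
        rw [integral_subtype_comap (isOpen_compl_singleton.measurableSet)
          fun y : Euc (n + 1) => ((radialBump ‖y‖ : ℝ) : ℂ) * h (sphereDir y),
          restrict_compl_singleton]
    _ = ∫ p : USphere (n + 1) × Ioi (0 : ℝ), h p.1 * ((radialBump (p.2 : ℝ) : ℝ) : ℂ)
          ∂((volume : Measure (Euc (n + 1))).toSphere.prod
            (.volumeIoiPow n)) := by
        have := (volume : Measure (Euc (n + 1))).measurePreserving_homeomorphUnitSphereProd
        simp only [finrank_euclideanSpace_fin, Nat.add_sub_cancel] at this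
        rw [← this.integral_comp (Homeomorph.measurableEmbedding _)]
        refine integral_congr_ae (Filter.Eventually.of_forall fun y => ?_)
        have hy : (y : Euc (n + 1)) ≠ 0 := y.2
        have : sphereDir (y : Euc (n + 1)) = (homeomorphUnitSphereProd _ y).1 :=
          Subtype.ext (by rw [coe_sphereDir hy]; simp)
        simp only [this, homeomorphUnitSphereProd_apply_snd_coe]
        ring
    _ = _ := integral_prod_mul h fun r : Ioi (0 : ℝ) => ((radialBump (r : ℝ) : ℝ) : ℂ)

/-- If it vanished, the polar formula with h = 1 would make the integral of a nonnegative continuous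
function zero, although the function equals 1 at a vector of norm 3/2. -/
theorem radialConst_ne_zero (n : ℕ) : radialConst n ≠ 0 := by
  intro h0
  have h := integral_radialBump_mul (n := n) fun _ => 1
  rw [h0, mul_zero] at h
  simp only [mul_one] at h
  rw [integral_complex_ofReal, Complex.ofReal_eq_zero] at h
  have hc : Continuous fun y : Euc (n + 1) => radialBump ‖y‖ :=
    radialBump.continuous.comp continuous_norm
  refine (hc.integral_pos_of_hasCompactSupport_nonneg_nonzero (μ := volume) ?_
    (fun y => radialBump.nonneg) (x := (3 / 2 : ℝ) • stdVec 0) ?_).ne' h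
  · refine HasCompactSupport.intro (isCompact_closedBall (0 : Euc (n + 1)) 2) fun y hy => ?_
    exact radialBump_eq_zero_of_ge (by simpa using (not_le.1 (mt mem_closedBall_zero_iff.2 hy)).le)
  · rw [norm_smul, norm_stdVec, mul_one, Real.norm_of_nonneg (by norm_num)]
    rw [radialBump.one_of_mem_closedBall]
    · exact one_ne_zero
    · rw [Metric.mem_closedBall, dist_self]
      exact radialBump.rIn_pos.le

end Polar

/-! ### The correlation as an integral over the annulus -/

section Correlation

variable {n : ℕ}

/-- The isomorphism `ℝᵈ / ℤᵈ → ℝᵈ / 2πℤᵈ`. -/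
noncomputable def torusScale (d : ℕ) (u : UnitAddTorus (Fin d)) : Torus d := fun i =>
  AddCircle.equivAddCircle 1 (2 * Real.pi) one_ne_zero Real.two_pi_pos.ne' (u i)

theorem torusScale_unitProj {d : ℕ} (v : Euc d) :
    torusScale d (unitProj d v) = proj d ((2 * Real.pi) • v) := by
  funext i
  simp only [torusScale, unitProj, proj]
  rw [AddCircle.equivAddCircle_apply_mk]
  congr 1
  simp
  ring

/-- The spatial correlation `∫ φ(x + 2πu, θ) conj ψ(x, θ) dx` at `θ = y / ‖y‖`, cut off radially. -/
noncomputable def spatialCor (φ ψ : STorus (n + 1) → ℂ) (u : UnitAddTorus (Fin (n + 1)))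
    (y : Euc (n + 1)) : ℂ :=
  ∫ x : Torus (n + 1), ((radialBump ‖y‖ : ℝ) : ℂ) *
    (φ (x + torusScale (n + 1) u, sphereDir y) * (starRingEnd ℂ) (ψ (x, sphereDir y)))

theorem isTorusAnnular_spatialCor {φ ψ : STorus (n + 1) → ℂ} (hφ : IsSmooth φ)
    (hψ : IsSmooth ψ) : IsTorusAnnular (spatialCor φ ψ) where
  contDiff := by
    refine contDiff_integral_of_lift (μ := (volume : Measure (Torus (n + 1))))
      (isOpenQuotientMap_proj (n + 1))
      (g := fun x (a : Euc (n + 1) × Euc (n + 1)) => ((radialBump ‖a.2‖ : ℝ) : ℂ) *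
        (φ (x + torusScale (n + 1) (unitProj (n + 1) a.1), sphereDir a.2) *
          (starRingEnd ℂ) (ψ (x, sphereDir a.2)))) ?_
    rw [contDiff_iff_contDiffAt]
    rintro ⟨x, v, y⟩
    rcases lt_or_ge ‖y‖ 1 with h | h
    · refine (contDiffAt_const (c := (0 : ℂ))).congr_of_eventuallyEq ?_
      have hc : ContinuousAt (fun b : Euc (n + 1) × Euc (n + 1) × Euc (n + 1) => b.2.2)
        (x, v, y) := by fun_prop
      filter_upwards [hc.eventually (eventually_norm_lt_one h)] with z hz
      rw [radialBump_eq_zero_of_le hz.le]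
      simp
    · have hy : y ≠ 0 := norm_pos_iff.1 (by linarith)
      have h1 : ContDiffAt ℝ ∞ (fun b : Euc (n + 1) × Euc (n + 1) × Euc (n + 1) =>
          ((radialBump ‖b.2.2‖ : ℝ) : ℂ)) (x, v, y) := by
        have hn : ContDiffAt ℝ ∞ (fun b : Euc (n + 1) × Euc (n + 1) × Euc (n + 1) => ‖b.2.2‖)
            (x, v, y) :=
          (contDiffAt_norm ℝ hy).comp (x, v, y) (contDiff_snd.comp contDiff_snd).contDiffAt
        exact Complex.ofRealCLM.contDiff.contDiffAt.comp _
          (radialBump.contDiff.contDiffAt.comp _ hn)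
      have h2 : ContDiffAt ℝ ∞ (fun b : Euc (n + 1) × Euc (n + 1) × Euc (n + 1) =>
          φ (proj (n + 1) (b.1 + (2 * Real.pi) • b.2.1), sphereDir b.2.2)) (x, v, y) := by
        have := hφ.contDiffAt_comp_sphereDir (a := (x + (2 * Real.pi) • v, y)) hy
        refine this.comp (x, v, y) (f := fun b : Euc (n + 1) × Euc (n + 1) × Euc (n + 1) =>
          (b.1 + (2 * Real.pi) • b.2.1, b.2.2)) ?_
        fun_prop
      have h3 : ContDiffAt ℝ ∞ (fun b : Euc (n + 1) × Euc (n + 1) × Euc (n + 1) =>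
          (starRingEnd ℂ) (ψ (proj (n + 1) b.1, sphereDir b.2.2))) (x, v, y) := by
        have := hψ.contDiffAt_comp_sphereDir (a := (x, y)) hy
        refine Complex.conjCLE.contDiff.contDiffAt.comp _ (this.comp (x, v, y)
          (f := fun b : Euc (n + 1) × Euc (n + 1) × Euc (n + 1) => (b.1, b.2.2)) ?_)
        fun_prop
      simp only [torusScale_unitProj]
      exact h1.mul (h2.mul h3)
  eq_zero_of_lt u y hy := by simp [spatialCor, radialBump_eq_zero_of_le hy.le]
  eq_zero_of_gt u y hy := by simp [spatialCor, radialBump_eq_zero_of_ge hy.le]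

theorem geodesicFlow_eq {d : ℕ} (t : ℝ) (p : STorus d) :
    geodesicFlow d t p = (p.1 + proj d (t • (p.2 : Euc d)), p.2) := rfl

/-- The shift u = tθ/2π becomes tθ after rescaling the torus, so the spatial integral is the
correlation at fixed direction θ; polar coordinates then split off the radial constant. -/
theorem integral_spatialCor {φ ψ : STorus (n + 1) → ℂ} (hφ : Continuous φ) (hψ : Continuous ψ)
    (t : ℝ) : ∫ y : Euc (n + 1), spatialCor φ ψ
      (unitProj (n + 1) ((t / (2 * Real.pi)) • (sphereDir y : Euc (n + 1)))) y =
        cor φ ψ t * radialConst n := by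
  have hint : Integrable (fun p => φ (geodesicFlow (n + 1) t p) * (starRingEnd ℂ) (ψ p))
      ((volume : Measure (Torus (n + 1))).prod
        (volume : Measure (Euc (n + 1))).toSphere) := by
    have : Continuous fun p => φ (geodesicFlow (n + 1) t p) * (starRingEnd ℂ) (ψ p) :=
      (hφ.comp ((continuous_geodesicFlow (n + 1)).comp
        (by fun_prop : Continuous fun p => (t, p)))).mul
        (Complex.continuous_conj.comp hψ)
    exact this.integrable_of_hasCompactSupport (HasCompactSupport.of_compactSpace _)
  rw [cor, liouville, integral_prod_symm _ hint, ← integral_radialBump_mul]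
  refine integral_congr_ae (Filter.Eventually.of_forall fun y => ?_)
  simp only [spatialCor]
  rw [integral_const_mul]
  simp only [geodesicFlow_eq, torusScale_unitProj, smul_smul,
    mul_div_cancel₀ t Real.two_pi_pos.ne']

end Correlation

end TorusFlow

namespace TorusFlow

/-! ### Expansion and filtering of the correlation -/

section FourierSeries

theorem norm_cexp_I_mul_mul (t r : ℝ) : ‖Complex.exp (Complex.I * t * r)‖ = 1 := by
  rw [mul_assoc, mul_comm, ← Complex.ofReal_mul, Complex.norm_exp_ofReal_mul_I]

theorem measurable_radialComponent {d : ℕ} (k : Euc d) :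
    Measurable (radialComponent k) := by
  unfold radialComponent
  exact (by fun_prop : Continuous fun y : Euc d => (inner ℝ k y : ℝ)).measurable.div
    measurable_norm

theorem IsAnnular.integrable {d : ℕ} {B : Euc d → ℂ} (hB : IsAnnular B) :
    Integrable B := by
  simpa using hB.integrable_comp_mul 0 (m := fun _ => 1) continuous_const

theorem IsAnnular.integral_norm_le {d : ℕ} {B : Euc d → ℂ} (hB : IsAnnular B)
    {M : ℝ} (hM : ∀ y, ‖B y‖ ≤ M) :
    ∫ y, ‖B y‖ ≤ M * volume.real (Metric.closedBall (0 : Euc d) 2) := by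
  rw [← setIntegral_eq_integral_of_forall_compl_eq_zero
    (s := Metric.closedBall (0 : Euc d) 2)]
  · refine (le_abs_self _).trans (norm_setIntegral_le_of_norm_le_const
      (f := fun y => ‖B y‖) measure_closedBall_lt_top fun y _ => ?_)
    rw [norm_norm]
    exact hM y
  · intro y hy
    rw [hB.eq_zero_of_gt y (by simpa using hy), norm_zero]

variable {n : ℕ} {φ ψ : STorus (n + 1) → ℂ}

theorem IsTorusAnnular.hasSum_radialComponent {q : UnitAddTorus (Fin (n + 1)) → Euc (n + 1) → ℂ}
    (hq : IsTorusAnnular q) (t : ℝ) (y : Euc (n + 1)) :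
    HasSum (fun k => Complex.exp (Complex.I * t * radialComponent (latticeVec k) y) *
      torusCoeff q k y)
      (q (unitProj (n + 1) ((t / (2 * Real.pi)) • (sphereDir y : Euc (n + 1)))) y) := by
  -- The direction assigned to y = 0 is arbitrary, but both sides vanish there.
  by_cases hy : y = 0
  · have h0 : ‖y‖ < 1 := by simp [hy]
    simp only [(hq.isAnnular_torusCoeff _).eq_zero_of_lt y h0, hq.eq_zero_of_lt _ y h0, mul_zero]
    exact hasSum_zero
  · convert! hq.hasSum_torusCoeff _ y using 2 with k
    rw [mFourier_unitProj, mul_comm, coe_sphereDir hy, inner_smul_right, inner_smul_right]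
    congr 2
    unfold radialComponent
    have := Real.pi_ne_zero
    push_cast
    field_simp

/-- Expansion of the correlation function in oscillatory integrals. -/
theorem hasSum_cor (hφ : IsSmooth φ) (hψ : IsSmooth ψ) (t : ℝ) :
    HasSum (fun k : Fin (n + 1) → ℤ => ∫ y : Euc (n + 1),
      Complex.exp (Complex.I * t * radialComponent (latticeVec k) y) *
        torusCoeff (spatialCor φ ψ) k y) (cor φ ψ t * radialConst n) := by
  have hq := isTorusAnnular_spatialCor hφ hψ
  obtain ⟨M, hM, hMk⟩ := hq.exists_summable_norm_torusCoeff_le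
  have hc : Continuous fun l : ℝ => Complex.exp (Complex.I * t * l) := by fun_prop
  rw [← integral_spatialCor hφ.continuous hψ.continuous]
  have h := hasSum_integral_of_summable_integral_norm
    (μ := (volume : Measure (Euc (n + 1))))
    (F := fun (k : Fin (n + 1) → ℤ) y =>
      Complex.exp (Complex.I * t * radialComponent (latticeVec k) y) *
        torusCoeff (spatialCor φ ψ) k y)
    (fun k => (hq.isAnnular_torusCoeff k).integrable_comp_mul (latticeVec k) hc) ?_
  · simpa only [(hq.hasSum_radialComponent t _).tsum_eq] using h
  · simp only [norm_mul, norm_cexp_I_mul_mul, one_mul]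
    exact Summable.of_nonneg_of_le (fun k => integral_nonneg fun y => norm_nonneg _)
      (fun k => (hq.isAnnular_torusCoeff k).integral_norm_le (hMk k)) (hM.mul_right _)

/-- The correlation function filtered by a kernel whose Fourier transform is `χ`. -/
theorem hasSum_integral_mul_cor (hφ : IsSmooth φ) (hψ : IsSmooth ψ) {H : ℝ → ℂ} {χ : ℝ → ℝ}
    (hH : Integrable H)
    (hHχ : ∀ l : ℝ, ∫ t, H t * Complex.exp (Complex.I * t * l) = (χ l : ℂ)) (s : ℝ) :
    HasSum (fun k : Fin (n + 1) → ℤ =>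
      oscIntegral χ (latticeVec k) 0 0 0 (torusCoeff (spatialCor φ ψ) k) s)
      ((∫ t, H (t - s) * cor φ ψ t) * radialConst n) := by
  have hq := isTorusAnnular_spatialCor hφ hψ
  obtain ⟨M, hM, hMk⟩ := hq.exists_summable_norm_torusCoeff_le
  have hHs : Integrable fun t => H (t - s) := hH.comp_sub_right s
  have hprod (k : Fin (n + 1) → ℤ) : Integrable (fun p : ℝ × Euc (n + 1) =>
      H (p.1 - s) * (Complex.exp (Complex.I * p.1 * radialComponent (latticeVec k) p.2) *
        torusCoeff (spatialCor φ ψ) k p.2)) (volume.prod volume) := by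
    have h1 := hHs.mul_prod (hq.isAnnular_torusCoeff k).integrable
    have hm : Measurable fun p : ℝ × Euc (n + 1) =>
        Complex.exp (Complex.I * p.1 * radialComponent (latticeVec k) p.2) := by
      have := measurable_radialComponent (latticeVec k)
      fun_prop
    refine (h1.bdd_mul (c := 1) hm.aestronglyMeasurable (Filter.Eventually.of_forall fun p =>
      (norm_cexp_I_mul_mul _ _).le)).congr (Filter.Eventually.of_forall fun p => ?_)
    simp only
    ring
  have hswap (k : Fin (n + 1) → ℤ) : ∫ t, H (t - s) * ∫ y : Euc (n + 1),
      Complex.exp (Complex.I * t * radialComponent (latticeVec k) y) *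
        torusCoeff (spatialCor φ ψ) k y =
      oscIntegral χ (latticeVec k) 0 0 0 (torusCoeff (spatialCor φ ψ) k) s := by
    simp only [← integral_const_mul]
    rw [integral_integral_swap (hprod k), oscIntegral]
    refine integral_congr_ae (Filter.Eventually.of_forall fun y => ?_)
    simp only [cutoffResolvent, iteratedDeriv_zero, pow_zero, inv_one, mul_one]
    -- The substitution t ↦ t + s splits off e^{isr} and leaves the transform of `H` at r, that is
    -- χ(r).
    rw [← hHχ, ← integral_add_right_eq_self _ s, ← integral_const_mul, ← integral_mul_const]
    refine integral_congr_ae (Filter.Eventually.of_forall fun t => ?_)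
    simp only [add_sub_cancel_right]
    rw [← mul_assoc, mul_left_comm, ← Complex.exp_add]
    congr 3
    push_cast
    ring
  have hint (k : Fin (n + 1) → ℤ) : Integrable fun t => H (t - s) *
      ∫ y : Euc (n + 1),
        Complex.exp (Complex.I * t * radialComponent (latticeVec k) y) *
          torusCoeff (spatialCor φ ψ) k y := by
    simpa only [integral_const_mul] using (hprod k).integral_prod_left
  have h := hasSum_integral_of_summable_integral_norm hint ?_
  · simp only [hswap] at h
    convert! h using 1
    rw [← integral_mul_const]
    refine integral_congr_ae (Filter.Eventually.of_forall fun t => ?_)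
    simp only
    rw [tsum_mul_left, (hasSum_cor hφ hψ t).tsum_eq, mul_assoc]
  · refine Summable.of_nonneg_of_le (fun k => integral_nonneg fun t => norm_nonneg _) (fun k => ?_)
      ((hM.mul_right (volume.real (Metric.closedBall (0 : Euc (n + 1)) 2))).mul_left
        (∫ t, ‖H (t - s)‖))
    rw [← integral_mul_const]
    refine integral_mono (hint k).norm (hHs.norm.mul_const _) fun t => ?_
    simp only [norm_mul]
    refine mul_le_mul_of_nonneg_left ((norm_integral_le_integral_norm _).trans ?_) (norm_nonneg _)
    simp only [norm_mul, norm_cexp_I_mul_mul, one_mul]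
    exact (hq.isAnnular_torusCoeff k).integral_norm_le (hMk k)

/-- Away from the frequencies `±‖k‖`, the filtered correlation function decays rapidly. -/
theorem exists_pow_mul_norm_integral_mul_cor_le (hφ : IsSmooth φ) (hψ : IsSmooth ψ)
    {H : ℝ → ℂ} {χ : ℝ → ℝ} (hH : Integrable H)
    (hHχ : ∀ l : ℝ, ∫ t, H t * Complex.exp (Complex.I * t * l) = (χ l : ℂ))
    (hχ : ContDiff ℝ ∞ χ) (hχc : HasCompactSupport χ) {δ : ℝ} (hδ : 0 < δ)
    (hgap : ∀ (k : Fin (n + 1) → ℤ), ∀ l ∈ tsupport χ,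
      δ ≤ |‖latticeVec k‖ - l| ∧ δ ≤ |‖latticeVec k‖ + l|) (N : ℕ) :
    ∃ C, ∀ s : ℝ, |s| ^ N * ‖∫ t, H (t - s) * cor φ ψ t‖ ≤ C := by
  have hq := isTorusAnnular_spatialCor hφ hψ
  obtain ⟨M, hM, hMk⟩ := hq.exists_summable_norm_iterate_le N
  obtain ⟨C, hC0, hC⟩ := exists_pow_mul_norm_oscIntegral_le
    (E := Euc (n + 1)) hχ hχc hδ N 0 0 0
  have hc := norm_pos_iff.2 (radialConst_ne_zero n)
  refine ⟨(∑' k, C * M k) / ‖radialConst n‖, fun s => ?_⟩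
  rw [le_div_iff₀ hc, mul_assoc, ← norm_mul]
  have h := (hasSum_integral_mul_cor hφ hψ hH hHχ s).mul_left ((s : ℂ) ^ N)
  have hb := tsum_of_norm_bounded (hM.mul_left C).hasSum (f := fun k : Fin (n + 1) → ℤ =>
    (s : ℂ) ^ N * oscIntegral χ (latticeVec k) 0 0 0 (torusCoeff (spatialCor φ ψ) k) s)
    fun k => by
      rw [norm_mul, norm_pow, Complex.norm_real, Real.norm_eq_abs]
      exact hC _ _ _ (hgap k) (hq.isAnnular_torusCoeff k) (hMk k) s
  rw [h.tsum_eq, norm_mul, norm_pow, Complex.norm_real, Real.norm_eq_abs] at hb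
  exact hb

end FourierSeries

end TorusFlow

namespace TorusFlow

/-! ### Restriction to positive times -/

section OneSided

/-- A Schwartz kernel with prescribed compactly supported smooth Fourier transform. -/
theorem exists_schwartz_integral_eq {χ : ℝ → ℝ} (hχ : ContDiff ℝ ∞ χ) (hχc : HasCompactSupport χ) :
    ∃ H : 𝓢(ℝ, ℂ), ∀ l : ℝ, ∫ t, H t * Complex.exp (Complex.I * t * l) = (χ l : ℂ) := by
  have h1 : HasCompactSupport fun l => (χ l : ℂ) := hχc.comp_left Complex.ofReal_zero
  have h2 : ContDiff ℝ ∞ fun l => (χ l : ℂ) := Complex.ofRealCLM.contDiff.comp hχ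
  let b : 𝓢(ℝ, ℂ) := h1.toSchwartzMap h2
  refine ⟨((2 * Real.pi : ℝ) : ℂ)⁻¹ • schwartzFourier b, fun l => ?_⟩
  have hb : 𝓕⁻ (𝓕 b) = b := FourierTransform.fourierInv_fourier_eq b
  have hbl : 𝓕⁻ (𝓕 b) l = (χ l : ℂ) := by rw [hb]; rfl
  rw [← hbl, SchwartzMap.fourierInv_coe, Real.fourierInv_eq']
  have hs (t : ℝ) : schwartzFourier b t = (𝓕 b) (t * (2 * Real.pi)⁻¹) := rfl
  have hpi := Real.two_pi_pos
  have := Measure.integral_comp_mul_right (fun r : ℝ =>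
    Complex.exp (((2 * Real.pi * inner ℝ r l : ℝ) : ℂ) * Complex.I) • (𝓕 b) r) (2 * Real.pi)⁻¹
  rw [inv_inv, abs_of_pos hpi] at this
  refine Eq.trans ?_ (inv_smul_smul₀ hpi.ne' _)
  rw [← this, ← integral_smul]
  refine integral_congr_ae (Filter.Eventually.of_forall fun t => ?_)
  simp only [smul_apply, hs, smul_eq_mul, Complex.real_smul]
  have hexp : Complex.exp (Complex.I * t * l) =
      Complex.exp (((2 * Real.pi * inner ℝ (t * (2 * Real.pi)⁻¹) l : ℝ) : ℂ) * Complex.I) := by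
    congr 1
    have := Real.pi_ne_zero
    simp
    field_simp
  rw [hexp]
  push_cast
  ring

variable {u : ℝ → ℂ} {A : ℝ}

/-- On S the weight |s|ᴺ is at most |t - s|ᴺ and is absorbed into the N-th moment of `H`. -/
theorem norm_setIntegral_schwartz_mul_le (H : 𝓢(ℝ, ℂ)) (hu : ∀ t, ‖u t‖ ≤ A) (N : ℕ) (s : ℝ)
    {S : Set ℝ} (hS : MeasurableSet S) (hs : ∀ t ∈ S, |s| ≤ |t - s|) :
    |s| ^ N * ‖∫ t in S, H (t - s) * u t‖ ≤ (∫ r, ‖r‖ ^ N * ‖H r‖) * A := by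
  have hA : 0 ≤ A := (norm_nonneg _).trans (hu 0)
  have hint : Integrable fun t => ‖t - s‖ ^ N * ‖H (t - s)‖ * A :=
    ((H.integrable_pow_mul volume N).comp_sub_right s).mul_const A
  calc |s| ^ N * ‖∫ t in S, H (t - s) * u t‖ = ‖∫ t in S, (s : ℂ) ^ N * (H (t - s) * u t)‖ := by
        rw [integral_const_mul, norm_mul, norm_pow, Complex.norm_real, Real.norm_eq_abs]
    _ ≤ ∫ t in S, ‖t - s‖ ^ N * ‖H (t - s)‖ * A := by
        refine norm_integral_le_of_norm_le hint.integrableOn ?_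
        filter_upwards [ae_restrict_mem hS] with t ht
        rw [norm_mul, norm_pow, norm_mul, ← mul_assoc, Complex.norm_real]
        have := hs t ht
        gcongr
        · exact this
        · exact hu t
    _ ≤ ∫ t, ‖t - s‖ ^ N * ‖H (t - s)‖ * A :=
        setIntegral_le_integral hint (Filter.Eventually.of_forall fun t => by positivity)
    _ = _ := by
        rw [integral_mul_const, integral_sub_right_eq_self (fun r => ‖r‖ ^ N * ‖H r‖) s]

/-- For s ≤ 0 the half-line t > 0 stays at distance at least |s| from s, so the tail of `H`
suffices. For s > 0 this holds for the complement, which is subtracted from the full integral. -/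
theorem exists_pow_mul_norm_setIntegral_le (H : 𝓢(ℝ, ℂ)) (hu : ∀ t, ‖u t‖ ≤ A)
    (huc : Continuous u) (N : ℕ) (h : ∃ C, ∀ s : ℝ, |s| ^ N * ‖∫ t, H (t - s) * u t‖ ≤ C) :
    ∃ C, ∀ s : ℝ, |s| ^ N * ‖∫ t in Ioi 0, H (t - s) * u t‖ ≤ C := by
  obtain ⟨C, hC⟩ := h
  set K := (∫ r, ‖r‖ ^ N * ‖H r‖) * A
  have hA : 0 ≤ A := (norm_nonneg _).trans (hu 0)
  have hK : 0 ≤ K := mul_nonneg (integral_nonneg fun r => by positivity) hA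
  refine ⟨C + K, fun s => ?_⟩
  have hC0 : 0 ≤ C := (by positivity : (0 : ℝ) ≤ |s| ^ N * _).trans (hC s)
  rcases le_or_gt s 0 with hs | hs
  · refine (norm_setIntegral_schwartz_mul_le H hu N s measurableSet_Ioi fun t ht => ?_).trans
      (by linarith)
    have : 0 < t := ht
    rw [abs_of_nonpos hs, abs_of_nonneg (by linarith)]
    linarith
  · have hint : Integrable fun t => H (t - s) * u t :=
      (H.integrable.comp_sub_right s).mul_bdd (c := A) huc.aestronglyMeasurable
        (Filter.Eventually.of_forall hu)
    have hsplit := integral_add_compl (measurableSet_Ioi (a := (0 : ℝ))) hint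
    rw [eq_sub_of_add_eq hsplit]
    have h2 := norm_setIntegral_schwartz_mul_le H hu N s (measurableSet_Ioi (a := (0 : ℝ))).compl
      fun t ht => by
        have : t ≤ 0 := by simpa using ht
        rw [abs_of_pos hs, abs_of_nonpos (by linarith)]
        linarith
    calc |s| ^ N * _ ≤ |s| ^ N * (‖∫ t, H (t - s) * u t‖ + ‖∫ t in (Ioi 0)ᶜ, H (t - s) * u t‖) := by
          gcongr
          exact norm_sub_le _ _
      _ ≤ C + K := by
          rw [mul_add]
          exact add_le_add (hC s) h2

theorem integrable_schwartz_mul_sub (H X : 𝓢(ℝ, ℂ)) (hu : ∀ t, ‖u t‖ ≤ A)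
    (hum : AEStronglyMeasurable u) :
    Integrable (fun p : ℝ × ℝ => u p.1 * (H (p.1 - p.2) * X p.2)) (volume.prod volume) := by
  have h := X.integrable.convolution_integrand (ContinuousLinearMap.mul ℝ ℂ) H.integrable
    (μ := (volume : Measure ℝ)) (ν := (volume : Measure ℝ))
  refine (h.bdd_mul (c := A) (f := fun p : ℝ × ℝ => u p.1) hum.comp_fst
    (Filter.Eventually.of_forall fun p => hu p.1)).congr (Filter.Eventually.of_forall fun p => ?_)
  simp only [ContinuousLinearMap.mul_apply']
  ring

/-- A test function supported where `χ = 1` has a Fourier transform reproduced by `H`. -/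
theorem schwartzFourier_eq_integral {H X : 𝓢(ℝ, ℂ)} {χ : ℝ → ℝ}
    (hHχ : ∀ l : ℝ, ∫ t, H t * Complex.exp (Complex.I * t * l) = (χ l : ℂ))
    (hX : ∀ l, (χ l : ℂ) * X l = X l) (t : ℝ) :
    schwartzFourier X t = ∫ s, H (t - s) * schwartzFourier X s := by
  have hint : Integrable (fun p : ℝ × ℝ => H (t - p.1) *
      (Complex.exp (-(Complex.I * p.1 * p.2)) * X p.2)) (volume.prod volume) := by
    have h1 := (H.integrable (μ := volume)).comp_sub_left t |>.mul_prod (X.integrable (μ := volume))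
    have hm : Continuous fun p : ℝ × ℝ => Complex.exp (-(Complex.I * p.1 * p.2)) := by fun_prop
    refine (h1.bdd_mul (c := 1) hm.aestronglyMeasurable
      (Filter.Eventually.of_forall fun p => ?_)).congr (Filter.Eventually.of_forall fun p => ?_)
    · rw [Complex.norm_exp]
      simp
    · simp only
      ring
  simp only [schwartzFourier_apply, ← integral_const_mul]
  rw [integral_integral_swap hint]
  refine integral_congr_ae (Filter.Eventually.of_forall fun l => ?_)
  simp only
  -- Replace X by χX, write χ as the transform of `H`, and reflect the variable by s ↦ t - s to
  -- obtain a convolution.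
  conv_lhs =>
    rw [← hX l, ← hHχ, ← integral_mul_const, ← integral_const_mul,
      ← integral_sub_left_eq_self _ _ t]
  refine integral_congr_ae (Filter.Eventually.of_forall fun s => ?_)
  simp only
  have : Complex.exp (-(Complex.I * s * l)) =
      Complex.exp (-(Complex.I * t * l)) * Complex.exp (Complex.I * (t - s : ℝ) * l) := by
    rw [← Complex.exp_add]
    congr 1
    push_cast
    ring
  rw [this]
  ring

end OneSided

end TorusFlow

namespace TorusFlow

/-! ### Smoothness of the one-sided Fourier transform -/

section Smoothness

variable {u : ℝ → ℂ} {A : ℝ} {H : 𝓢(ℝ, ℂ)} {χ : ℝ → ℝ}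

theorem integrable_pow_mul_norm_of_decay {G : ℝ → ℂ} (hG : AEStronglyMeasurable G)
    (hd : ∀ N : ℕ, ∃ C, ∀ s : ℝ, |s| ^ N * ‖G s‖ ≤ C) (N : ℕ) :
    Integrable fun s => ‖s‖ ^ N * ‖G s‖ := by
  obtain ⟨C, hC⟩ := hd N
  -- Two further powers give domination by a multiple of the integrable function 1/(1 + s²).
  obtain ⟨C', hC'⟩ := hd (N + 2)
  refine (integrable_inv_one_add_sq.const_mul (C + C')).mono'
    ((continuous_norm.pow N).aestronglyMeasurable.mul hG.norm)
    (Filter.Eventually.of_forall fun s => ?_)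
  rw [Real.norm_of_nonneg (by positivity), ← div_eq_mul_inv, le_div_iff₀ (by positivity),
    Real.norm_eq_abs]
  have h1 := hC s
  have h2 := hC' s
  rw [pow_add, sq_abs] at h2
  linarith

/-- The one-sided Fourier transform of `u` is smooth where `χ = 1`, if the part of `u` filtered by
the kernel of `χ` decays rapidly. -/
theorem exists_contDiff_integral_eq (hu : ∀ t, ‖u t‖ ≤ A) (huc : Continuous u)
    (hHχ : ∀ l : ℝ, ∫ t, H t * Complex.exp (Complex.I * t * l) = (χ l : ℂ))
    (hd : ∀ N : ℕ, ∃ C, ∀ s : ℝ, |s| ^ N * ‖∫ t in Ioi 0, H (t - s) * u t‖ ≤ C) :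
    ∃ f : ℝ → ℂ, ContDiff ℝ ∞ f ∧ ∀ X : 𝓢(ℝ, ℂ), (∀ l, (χ l : ℂ) * X l = X l) →
      ∫ t in Ioi 0, u t * schwartzFourier X t = ∫ l, f l * X l := by
  set G : ℝ → ℂ := fun s => ∫ t in Ioi 0, H (t - s) * u t with hGdef
  have hGm : AEStronglyMeasurable G := by
    have hc : Continuous fun p : ℝ × ℝ => H (p.2 - p.1) * u p.2 :=
      (H.continuous.comp (by fun_prop)).mul (huc.comp continuous_snd)
    exact (hc.aestronglyMeasurable
      (μ := volume.prod (volume.restrict (Ioi 0)))).integral_prod_right'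
  have hGi := integrable_pow_mul_norm_of_decay hGm hd
  have hG : Integrable G := (hGi 0).mono hGm (Filter.Eventually.of_forall fun s => by simp)
  let F : ℝ → ℂ := fun l => (𝓕 G) (l * (2 * Real.pi)⁻¹)
  refine ⟨F, (Real.contDiff_fourier (N := ⊤) fun N _ => hGi N).comp (contDiff_id.mul
    contDiff_const),
    fun X hX => ?_⟩
  have hf (l : ℝ) : F l = ∫ s : ℝ, Complex.exp (-(Complex.I * s * l)) * G s := by
    simp only [F, Real.fourier_eq']
    refine integral_congr_ae (Filter.Eventually.of_forall fun s => ?_)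
    simp only [smul_eq_mul]
    congr 2
    have := Real.pi_ne_zero
    simp
    field_simp
  set U : ℝ → ℂ := (Ioi (0 : ℝ)).indicator u with hU
  have hUb (t : ℝ) : ‖U t‖ ≤ A := (norm_indicator_le_norm_self u t).trans (hu t)
  have hUm : AEStronglyMeasurable U := huc.aestronglyMeasurable.indicator measurableSet_Ioi
  have hG' (s : ℝ) : G s = ∫ t, U t * H (t - s) := by
    simp only [hGdef]
    rw [← integral_indicator measurableSet_Ioi]
    refine integral_congr_ae (Filter.Eventually.of_forall fun t => ?_)
    by_cases ht : t ∈ Ioi (0 : ℝ)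
    · simp only [hU, indicator_of_mem ht]
      ring
    · simp only [hU, indicator_of_notMem ht, zero_mul]
  have hint1 := integrable_schwartz_mul_sub H (schwartzFourier X) hUb hUm
  have hint2 : Integrable (fun p : ℝ × ℝ => Complex.exp (-(Complex.I * p.1 * p.2)) * X p.2 * G p.1)
      (volume.prod volume) := by
    have h1 := hG.mul_prod (X.integrable (μ := volume))
    have hm : Continuous fun p : ℝ × ℝ => Complex.exp (-(Complex.I * p.1 * p.2)) := by fun_prop
    refine (h1.bdd_mul (c := 1) hm.aestronglyMeasurable
      (Filter.Eventually.of_forall fun p => ?_)).congr (Filter.Eventually.of_forall fun p => ?_)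
    · rw [Complex.norm_exp]
      simp
    · simp only
      ring
  -- Insert the reproducing formula for the transform of X, integrate in t first to form `G`, then
  -- move the Fourier transform from X onto `G`.
  calc ∫ t in Ioi 0, u t * schwartzFourier X t = ∫ t, U t * schwartzFourier X t := by
        rw [← integral_indicator measurableSet_Ioi]
        refine integral_congr_ae (Filter.Eventually.of_forall fun t => ?_)
        simp only [hU, indicator_mul_left]
    _ = ∫ t, ∫ s, U t * (H (t - s) * schwartzFourier X s) := by
        simp only [integral_const_mul, ← schwartzFourier_eq_integral hHχ hX]
    _ = ∫ s, ∫ t, U t * (H (t - s) * schwartzFourier X s) := integral_integral_swap hint1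
    _ = ∫ s : ℝ, ∫ l : ℝ, Complex.exp (-(Complex.I * s * l)) * X l * G s := by
        refine integral_congr_ae (Filter.Eventually.of_forall fun s => ?_)
        simp only [← mul_assoc, integral_mul_const, ← hG', schwartzFourier_apply]
        exact mul_comm _ _
    _ = ∫ l : ℝ, ∫ s : ℝ, Complex.exp (-(Complex.I * s * l)) * X l * G s :=
        integral_integral_swap hint2
    _ = ∫ l, F l * X l := by
        refine integral_congr_ae (Filter.Eventually.of_forall fun l => ?_)
        simp only [hf, ← integral_mul_const]
        exact integral_congr_ae (Filter.Eventually.of_forall fun s => by simp only; ring)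

end Smoothness

/-! ### Characters, eigenvalues and the spectral gap -/

section Spectrum

variable {d : ℕ}

/-- The character `x ↦ e^{ik·x}` of the torus. -/
noncomputable def torusChar (k : Fin d → ℤ) (x : Torus d) : ℂ := ∏ j, fourier (k j) (x j)

theorem torusChar_proj (k : Fin d → ℤ) (x : EuclideanSpace ℝ (Fin d)) :
    torusChar k (proj d x) = Complex.exp (Complex.I * (inner ℝ (latticeVec k) x : ℝ)) := by
  simp only [torusChar, proj, latticeVec, fourier_coe_apply, PiLp.inner_apply]
  rw [← Complex.exp_sum]
  congr 1
  push_cast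
  rw [Finset.mul_sum]
  refine Finset.sum_congr rfl fun j _ => ?_
  have := Real.pi_ne_zero
  simp
  field_simp

/-- The character e^{ik·x} is an eigenfunction. Only this direction is needed: every ‖k‖ lies in the
spectrum, and no classification of eigenvalues is used. -/
theorem isLaplaceEigenvalue_norm_latticeVec_sq (k : Fin d → ℤ) :
    IsLaplaceEigenvalue d (‖latticeVec k‖ ^ 2) := by
  set L : EuclideanSpace ℝ (Fin d) →L[ℝ] ℂ :=
    Complex.I • Complex.ofRealCLM.comp (innerSL ℝ (latticeVec k)) with hL
  have hu (x : EuclideanSpace ℝ (Fin d)) : torusChar k (proj d x) = Complex.exp (L x) := by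
    rw [torusChar_proj]
    rfl
  have hd (x : EuclideanSpace ℝ (Fin d)) :
      HasFDerivAt (fun x => Complex.exp (L x)) (Complex.exp (L x) • L) x := L.hasFDerivAt.cexp
  have hd2 (x : EuclideanSpace ℝ (Fin d)) : HasFDerivAt (fun x => Complex.exp (L x) • L)
      ((Complex.exp (L x) • L).smulRight L) x := (hd x).smul_const L
  refine ⟨torusChar k, fun h => ?_, ?_, fun x => ?_⟩
  · have := hu 0
    rw [h] at this
    simp at this
  · simp only [hu]
    exact L.contDiff.cexp
  · simp only [hu]
    rw [InnerProductSpace.laplacian_eq_iteratedFDeriv_orthonormalBasis _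
      (EuclideanSpace.basisFun (Fin d) ℝ)]
    have hf : fderiv ℝ (fun x => Complex.exp (L x)) = fun x => Complex.exp (L x) • L :=
      funext fun x => (hd x).fderiv
    simp only [iteratedFDeriv_two_apply, hf, (hd2 x).fderiv]
    have hLj (j : Fin d) : L (EuclideanSpace.single j 1) = Complex.I * k j := by
      rw [hL]
      have := inner_latticeVec_stdVec k j
      rw [stdVec] at this
      simp [this]
    have hn : (‖latticeVec k‖ ^ 2 : ℝ) = ∑ j, (k j : ℝ) ^ 2 := by
      rw [EuclideanSpace.norm_sq_eq]
      simp [latticeVec]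
    rw [hn]
    push_cast
    rw [Finset.sum_mul, ← Finset.sum_neg_distrib]
    refine Finset.sum_congr rfl fun j _ => ?_
    simp [hLj]
    linear_combination (-(Complex.exp (L x) * (k j) ^ 2)) * Complex.I_sq

/-- The squared norms are integers, and any set of integers is closed in ℝ. Squaring treats both
signs ±‖k‖ at once. -/
theorem isClosed_sq_eq_norm_latticeVec_sq (d : ℕ) :
    IsClosed {l : ℝ | ∃ k : Fin d → ℤ, l ^ 2 = ‖latticeVec k‖ ^ 2} := by
  have h : IsClosed ((fun m : ℤ => (m : ℝ)) '' {m | ∃ k : Fin d → ℤ, m = ∑ j, k j ^ 2}) :=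
    Int.isClosedEmbedding_coe_real.isClosedMap _ (isClosed_discrete _)
  convert! h.preimage (continuous_pow 2 : Continuous fun l : ℝ => l ^ 2) using 1
  ext l
  have hn (k : Fin d → ℤ) : (‖latticeVec k‖ ^ 2 : ℝ) = ((∑ j, k j ^ 2 : ℤ) : ℝ) := by
    rw [EuclideanSpace.norm_sq_eq]
    simp [latticeVec]
  simp only [mem_ofPred_eq, mem_preimage, mem_image, hn]
  constructor
  · rintro ⟨k, hk⟩
    exact ⟨_, ⟨k, rfl⟩, hk.symm⟩
  · rintro ⟨_, ⟨k, rfl⟩, hk⟩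
    exact ⟨k, hk.symm⟩

/-- A real number outside the spectrum of `±√-Δ` is separated from all the frequencies `±‖k‖`. -/
theorem exists_gap {l : ℝ} (hl : l ∉ spSqrtLaplacian d ∪ spNegSqrtLaplacian d) :
    ∃ δ > 0, ∀ k : Fin d → ℤ, ∀ m ∈ Metric.closedBall l δ,
      δ ≤ |‖latticeVec k‖ - m| ∧ δ ≤ |‖latticeVec k‖ + m| := by
  have hmem : l ∈ {l : ℝ | ∃ k : Fin d → ℤ, l ^ 2 = ‖latticeVec k‖ ^ 2}ᶜ := by
    rintro ⟨k, hk⟩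
    have he : IsLaplaceEigenvalue d (l ^ 2) := hk ▸ isLaplaceEigenvalue_norm_latticeVec_sq k
    rcases le_total 0 l with h | h
    · exact hl (Or.inl ⟨h, he⟩)
    · exact hl (Or.inr ⟨by linarith, by rwa [neg_sq]⟩)
  obtain ⟨ε, hε, hball⟩ := Metric.isOpen_iff.1 (isClosed_sq_eq_norm_latticeVec_sq d).isOpen_compl
    l hmem
  have hfar (k : Fin d → ℤ) (r : ℝ) (hr : r ^ 2 = ‖latticeVec k‖ ^ 2) : ε ≤ |r - l| := by
    by_contra! h
    exact hball (show r ∈ Metric.ball l ε from h) ⟨k, hr⟩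
  -- Every ±‖k‖ is at distance at least ε from l; moving from l to m loses at most ε/2.
  refine ⟨ε / 2, by positivity, fun k m hm => ?_⟩
  rw [Metric.mem_closedBall, Real.dist_eq] at hm
  have h1 := hfar k ‖latticeVec k‖ rfl
  have h2 := hfar k (-‖latticeVec k‖) (by ring)
  constructor
  · have := abs_sub_le ‖latticeVec k‖ m l
    linarith
  · have := abs_sub_le (-‖latticeVec k‖) m l
    rw [show -‖latticeVec k‖ - m = -(‖latticeVec k‖ + m) by ring, abs_neg] at this
    linarith

end Spectrum

/-! ### Boundedness of the correlation and conclusion -/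

theorem exists_norm_cor_le {d : ℕ} {φ ψ : STorus d → ℂ} (hφ : Continuous φ) (hψ : Continuous ψ) :
    ∃ A, ∀ t, ‖cor φ ψ t‖ ≤ A := by
  obtain ⟨A, hA⟩ := isCompact_univ.exists_bound_of_continuousOn hφ.continuousOn
  obtain ⟨B, hB⟩ := isCompact_univ.exists_bound_of_continuousOn hψ.continuousOn
  refine ⟨A * B * (liouville d).real univ, fun t =>
    norm_integral_le_of_norm_le_const (Filter.Eventually.of_forall fun p => ?_)⟩
  rw [norm_mul, RCLike.norm_conj]
  exact mul_le_mul (hA _ (mem_univ _)) (hB _ (mem_univ _)) (norm_nonneg _)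
    ((norm_nonneg _).trans (hA (geodesicFlow d t p) (mem_univ _)))

end TorusFlow

theorem mainTheorem10 (n : ℕ) (φ ψ : TorusFlow.STorus (n + 1) → ℂ)
    (hφ : TorusFlow.IsSmooth φ) (hψ : TorusFlow.IsSmooth ψ) :
    TorusFlow.singSupport (TorusFlow.fourierCor hφ hψ) ⊆
      TorusFlow.spSqrtLaplacian (n + 1) ∪ TorusFlow.spNegSqrtLaplacian (n + 1) := by
  intro l hl
  by_contra hsp
  obtain ⟨δ, hδ, hgap⟩ := TorusFlow.exists_gap hsp
  -- The support is the closed ball of radius δ on which the gap holds, and χ = 1 on the ball of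
  -- radius δ/2, where smoothness will be shown.
  let χ : ContDiffBump l := ⟨δ / 2, δ, by positivity, by linarith⟩
  obtain ⟨H, hH⟩ := TorusFlow.exists_schwartz_integral_eq χ.contDiff χ.hasCompactSupport
  obtain ⟨A, hA⟩ := TorusFlow.exists_norm_cor_le hφ.continuous hψ.continuous
  have hc := TorusFlow.continuous_cor hφ.continuous hψ.continuous
  obtain ⟨f, hf, hfX⟩ := TorusFlow.exists_contDiff_integral_eq hA hc hH fun N =>
    TorusFlow.exists_pow_mul_norm_setIntegral_le H hA hc N
      (TorusFlow.exists_pow_mul_norm_integral_mul_cor_le hφ hψ H.integrable hH χ.contDiff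
        χ.hasCompactSupport hδ (fun k m hm => hgap k m (χ.tsupport_eq ▸ hm)) N)
  refine hl (mem_sUnion.2 ⟨Metric.ball l (δ / 2), ⟨Metric.isOpen_ball, f, hf.contDiffOn,
    fun X _ hX => ?_⟩, Metric.mem_ball_self (by positivity)⟩)
  -- It remains to check χX = X: on the support of X the cutoff is 1, and elsewhere X vanishes.
  rw [TorusFlow.fourierCor_apply, ← hfX X fun m => ?_]
  · simp only [TorusFlow.schwartzFourier_apply]
  · by_cases hm : m ∈ tsupport X
    · rw [χ.one_of_mem_closedBall (Metric.ball_subset_closedBall (hX hm))]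
      simp
    · rw [image_eq_zero_of_notMem_tsupport hm, mul_zero]
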